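/- Consider a finite discounted MDP with state space $[S]$, action space $[A]$, transition kernel $P$, reward function $r:[S]\times[A]\to[0,1]$ and discount factor $\gamma\in(0,1)$. Policies are maps $\pi:[S]\to[A]$; $Q^\pi(s,a)$ and $V^\pi(s)=Q^\pi(s,\pi(s))$ are the expected total discounted rewards, and $V^*(s)=\max_\pi V^\pi(s)$. A query of the generative model at $(s,a)$ returns $r(s,a)$ and a fresh sample from $P(\cdot\mid s,a)$. Let $d\ge 1$, and let $\Phi\in\mathbb R^{SA\times d}$ be a feature matrix with rows $\Phi(s,a)$ that span $\mathbb R^d$. Let $\varepsilon>0$, $\alpha\in(0,1)$, and suppose that for every policy $\pi$ there is $\theta\in\mathbb R^d$ with $\|Q^\pi-\Phi\theta\|_\infty\le\varepsilon$ (that is, $Q^\pi\in\mathcal H_\Phi^\varepsilon$). For a probability distribution $\rho$ on $[S]\times[A]$ with support (core set) $\mathcal C$ let $G(\rho)=\sum_{(s,a)\in\mathcal C}\rho(s,a)\Phi(s,a)\Phi(s,a)^\top$. Call $\rho$ near-optimal if $G(\rho)$ is invertible and $g(\rho)=\max_{s,a}\Phi(s,a)^\top G(\rho)^{-1}\Phi(s,a)\le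 2d$. Approximate policy iteration starts from an arbitrary policy $\pi_1$. In iteration $i=1,\dots,k$ it takes $m$ independent roll-outs of length $n$ from each $(s,a)\in\mathcal C$ following $\pi_i$, lets $\hat Q_i(s,a)$ be the average of the $m$ discounted sums of the $n$ rewards, sets $\hat\theta_i=G(\rho)^{-1}\sum_{(s,a)\in\mathcal C}\rho(s,a)\Phi(s,a)\hat Q_i(s,a)$ and $Q_i=\Phi\hat\theta_i$, and takes for $\pi_{i+1}$ a policy that is greedy with respect to $Q_i$ (with ties broken by a fixed but arbitrary function of $Q_i$). The output is $\pi_{k+1}$. With $\lceil x\rceil_+=\max\{0,\lceil x\rceil\}$, let $$k=\left\lceil\frac{\log\frac1{\varepsilon\sqrt d}}{1-\gamma}\right\rceil_+,\qquad n=\left\lceil\frac{\log\frac1{\varepsilon(1-\gamma)}}{1-\gamma}\right\rceil_+,$$ and $m=\left\lceil\frac{\log(2k|\mathcal C|/\alpha)}{2\varepsilon^2(1-\gamma)^2}\right\rceil_+$ (if $k=0$, no iteration is run, no sample is used, and $m$ is irrelevant). Write $\log_\bullet x=\max\{1,\log x\}$ for $x>0$, and $\log_\bullet x=1$ for $x=0$.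 There is a universal constant $C>0$ such that, in this setting, the following hold. 1. For every near-optimal $\rho$, every $\pi_1$ and every tie-breaking rule, with probability at least $1-\alpha$, $$\max_{s\in[S]}\bigl(V^*(s)-V^{\pi_{k+1}}(s)\bigr)\le\frac{C\varepsilon\sqrt d}{(1-\gamma)^2}.$$ 2. The number of samples from the generative model is always exactly $kmn|\mathcal C|$, and $$kmn|\mathcal C|\le C\,\frac{\log_\bullet\!\left(\frac1{\varepsilon(1-\gamma)}\right)\log_\bullet\!\left(\frac{2k|\mathcal C|}{\alpha}\right)\log_\bullet\!\left(\frac1{\varepsilon\sqrt d}\right)|\mathcal C|}{\varepsilon^2(1-\gamma)^4}.$$ If $d\ge2$ and $|\mathcal C|\le 4d\log\log d+16$, or if $d=1$ and $|\mathcal C|\le16$, the same bound holds with the last factor $|\mathcal C|$ of the numerator replaced by $d\log_\bullet\log d$. 3. There is a near-optimal $\rho$ with $|\mathcal C|\le C\,d\log_\bullet\log d$, so that the number of samples is of order $d/(\varepsilon^2(1-\gamma)^4)$ up to logarithmic factors, independently of $S$ and $A$. -/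

import Mathlib

open scoped Matrix Pointwise

/-- A discounted Markov decision process with transition kernel `P`, reward function
`r` with values in `[0, 1]` and discount factor `γ ∈ (0, 1)`. -/
structure MDP (S A : Type) where
  P : S → A → PMF S
  r : S → A → ℝ
  γ : ℝ
  r_mem : ∀ s a, r s a ∈ Set.Icc (0 : ℝ) 1
  γ_mem : γ ∈ Set.Ioo (0 : ℝ) 1

namespace MDP

variable {S A : Type} [Fintype S]

/-- The operator `(P^π Q)(s, a) = ∑ s', P(s' | s, a) Q(s', π(s'))`. -/
noncomputable def transOp (M : MDP S A) (π : S → A) (Q : S × A → ℝ) : S × A → ℝ :=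
  fun x => ∑ s' : S, (M.P x.1 x.2 s').toReal * Q (s', π s')

/-- The expected reward received at time `t` when the process starts with the state-action pair
`x` and follows `π` from time `1` on. -/
noncomputable def expectedReward (M : MDP S A) (π : S → A) (t : ℕ) : S × A → ℝ :=
  (M.transOp π)^[t] (fun x => M.r x.1 x.2)

/-- The action-value function `Q^π`: the total expected discounted reward. -/
noncomputable def Qval (M : MDP S A) (π : S → A) : S × A → ℝ :=
  fun x => ∑' t : ℕ, M.γ ^ t * M.expectedReward π t x

/-- The value function `V^π`. -/
noncomputable def V (M : MDP S A) (π : S → A) (s : S) : ℝ := M.Qval π (s, π s)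

/-- The optimal value function `V^*`. -/
noncomputable def Vopt (M : MDP S A) (s : S) : ℝ := ⨆ π : S → A, M.V π s

end MDP

/-- The set `H_Φ^ε = range Φ + [-ε, ε]^ι`. -/
def hypothesisClass {ι : Type} {d : ℕ} (Φ : Matrix ι (Fin d) ℝ) (ε : ℝ) : Set (ι → ℝ) :=
  Set.range (fun θ : Fin d → ℝ => Φ *ᵥ θ) + Set.Icc (fun _ => -ε) (fun _ => ε)

section Design

variable {ι : Type} [Fintype ι] {d : ℕ}

/-- The core set (support) of a design. -/
noncomputable def coreSet (ρ : ι → ℝ) : Finset ι :=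
  letI := Classical.decPred (fun i => ρ i ≠ 0)
  Finset.univ.filter (fun i => ρ i ≠ 0)

/-- The matrix `G(ρ) = ∑ ρ(i) Φ(i) Φ(i)ᵀ`, the sum running over the core set. -/
noncomputable def designMatrix (Φ : Matrix ι (Fin d) ℝ) (ρ : ι → ℝ) : Matrix (Fin d) (Fin d) ℝ :=
  ∑ i ∈ coreSet ρ, ρ i • Matrix.vecMulVec (Φ i) (Φ i)

/-- `g(ρ) = max_i ‖Φ(i)‖²` in the norm of `G(ρ)⁻¹`; meaningful when `G(ρ)` is invertible. -/
noncomputable def designG (Φ : Matrix ι (Fin d) ℝ) (ρ : ι → ℝ) : ℝ :=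
  ⨆ i : ι, Φ i ⬝ᵥ ((designMatrix Φ ρ)⁻¹ *ᵥ Φ i)

/-- `ρ` is a probability distribution on the index set of the features, `G(ρ)` is invertible,
and `g(ρ) ≤ 2d`. -/
structure IsNearOptimalDesign (Φ : Matrix ι (Fin d) ℝ) (ρ : ι → ℝ) : Prop where
  nonneg : ∀ i, 0 ≤ ρ i
  sum_eq_one : ∑ i, ρ i = 1
  isUnit_det : IsUnit (designMatrix Φ ρ).det
  designG_le : designG Φ ρ ≤ 2 * d

/-- The least-squares extension `Φ θ̂` with
`θ̂ = G(ρ)⁻¹ ∑_{i in the core set} ρ(i) q(i) Φ(i)`. -/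
noncomputable def lsExtension (Φ : Matrix ι (Fin d) ℝ) (ρ : ι → ℝ) (q : ι → ℝ) : ι → ℝ :=
  Φ *ᵥ ((designMatrix Φ ρ)⁻¹ *ᵥ (∑ i ∈ coreSet ρ, (ρ i * q i) • Φ i))

end Design

/-- Programs of a learner that has access to a generative model: a program either
returns a value, or queries a state-action pair and continues, depending on the reward and
the next state that it receives as the answer. -/
inductive GenProg (S A β : Type) : Type where
  | ret : β → GenProg S A β
  | query : S → A → (ℝ → S → GenProg S A β) → GenProg S A β

namespace GenProg

variable {S A β δ : Type}

/-- Sequential composition. -/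
def bind : GenProg S A β → (β → GenProg S A δ) → GenProg S A δ
  | ret b, f => f b
  | query s a k, f => query s a (fun x s' => (k x s').bind f)

/-- Post-processing of the output. -/
def map (f : β → δ) (p : GenProg S A β) : GenProg S A δ := p.bind (fun b => ret (f b))

/-- The law of the output when queries are answered by the MDP `M`: a query of `(s, a)`
returns the reward `r(s, a)` and a fresh sample of the next state from `P(· | s, a)`. -/
noncomputable def run (M : MDP S A) : GenProg S A β → PMF β
  | ret b => PMF.pure b
  | query s a k => (M.P s a).bind (fun s' => (k (M.r s a) s').run M)

/-- The probability that the output lies in `E`. -/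
noncomputable def prob (M : MDP S A) (p : GenProg S A β) (E : Set β) : ENNReal :=
  (p.run M).toOuterMeasure E

/-- The program makes exactly `N` queries, whatever the answers are. -/
def QueriesExactly : GenProg S A β → ℕ → Prop
  | ret _, N => N = 0
  | query _ _ k, N => ∃ N', N = N' + 1 ∧ ∀ x s', (k x s').QueriesExactly N'

/-- A roll-out of length `n` from `(s, a)` following `π`; it returns the discounted
sum of the `n` rewards received. -/
def rollout (γ : ℝ) (π : S → A) : ℕ → S → A → GenProg S A ℝ
  | 0, _, _ => ret 0
  | n + 1, s, a => query s a (fun x s' => (rollout γ π n s' (π s')).map (fun R => x + γ * R))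

/-- The sum of the outputs of `m` independent runs. -/
def sumRuns (p : GenProg S A ℝ) : ℕ → GenProg S A ℝ
  | 0 => ret 0
  | m + 1 => p.bind (fun x => (sumRuns p m).map (fun y => x + y))

/-- The average of the outputs of `m` independent runs. -/
noncomputable def average (p : GenProg S A ℝ) (m : ℕ) : GenProg S A ℝ :=
  (sumRuns p m).map (fun y => y / m)

open Classical in
/-- Run the program `p c` for each `c` in a list and collect the outputs in a function (which is
`0` off the list). -/
noncomputable def tabulate (p : S × A → GenProg S A ℝ) : List (S × A) → GenProg S A (S × A → ℝ)
  | [] => ret 0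
  | c :: l => (p c).bind (fun x => (tabulate p l).map (fun q => Function.update q c x))

/-- The estimate `Q̂` on the core set: for each pair in it, the empirical average of `m` roll-outs
of length `n` following `π`. -/
noncomputable def estimateQ [Fintype S] [Fintype A] (γ : ℝ) (ρ : S × A → ℝ) (m n : ℕ)
    (π : S → A) : GenProg S A (S × A → ℝ) :=
  tabulate (fun c => (rollout γ π n c.1 c.2).average m) (coreSet ρ).toList

/-- Approximate policy iteration: `k` iterations from the policy `π`, each of which
estimates the action values of the current policy on the core set by roll-outs, extends the
estimate by least squares and passes to a greedy policy, as selected by `greedy`. With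
initial policy `π₁` the output is `π_{k+1}`. -/
noncomputable def approxPolicyIteration [Fintype S] [Fintype A] {d : ℕ} (γ : ℝ)
    (Φ : Matrix (S × A) (Fin d) ℝ) (ρ : S × A → ℝ) (greedy : (S × A → ℝ) → S → A) (m n : ℕ) :
    ℕ → (S → A) → GenProg S A (S → A)
  | 0, π => ret π
  | k + 1, π => (estimateQ γ ρ m n π).bind
      (fun q => approxPolicyIteration γ Φ ρ greedy m n k (greedy (lsExtension Φ ρ q)))

end GenProg

/-- `greedy` maps every action-value function to a policy that is greedy with respect to it. -/
def IsGreedySelector {S A : Type} (greedy : (S × A → ℝ) → S → A) : Prop :=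
  ∀ (Q : S × A → ℝ) (s : S) (a : A), Q (s, a) ≤ Q (s, greedy Q s)

/-- The number of iterations, `log(1/(ε√d)) / (1-γ)` rounded up. -/
noncomputable def numIter (d : ℕ) (ε γ : ℝ) : ℕ :=
  ⌈Real.log (1 / (ε * √(d : ℝ))) / (1 - γ)⌉₊

/-- The number of roll-outs per core pair, `log(2kc/α) / (2ε²(1-γ)²)` rounded up, where `k` is the
number of iterations and `c` the size of the core set. -/
noncomputable def numRollouts (k c : ℕ) (ε γ α : ℝ) : ℕ :=
  ⌈Real.log (2 * k * c / α) / (2 * ε ^ 2 * (1 - γ) ^ 2)⌉₊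

/-- The length of a roll-out, `log(1/(ε(1-γ))) / (1-γ)` rounded up. -/
noncomputable def rolloutLength (ε γ : ℝ) : ℕ :=
  ⌈Real.log (1 / (ε * (1 - γ))) / (1 - γ)⌉₊

/-- `max {1, log x}`. -/
noncomputable def logPlus (x : ℝ) : ℝ := max 1 (Real.log x)

/-! Accuracy. Least squares on a near-optimal design is stable: by Cauchy–Schwarz with weights `ρ`,
an error `δ` on the core set grows to at most `δ√(2d)` anywhere
(`IsNearOptimalDesign.abs_lsExtension_le`). As `Q^π` is within `ε` of the range of `Φ`, estimates
accurate to `2ε` on the core set yield action values accurate to `η = 6ε√d` everywhere. A greedy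
step with such values turns a bound `B` on `V^σ - V^π` into `γB + 2η/(1-γ)`
(`MDP.V_sub_V_greedy_le`). Iterating from `1/(1-γ)` leaves `γ^k/(1-γ)`, which the choice of `k`
controls, and a geometric series of order `ε√d/(1-γ)²`. In the estimates, `ε` pays for truncating
the roll-outs and `ε` for sampling noise; Hoeffding's inequality and a union bound over iterations
and core pairs give the confidence `1-α`.

Small core sets. The Frank–Wolfe method increases `log det G(ρ)`, starting from `d` rows of maximal
volume, where `g ≤ d²`. Put `L = log(g/d)`. While `L ≥ log 2`, a step gains at least `L/4` and adds
at most one point, whereas no design is better by more than `dL` (`log_det_designMatrix_le`). The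
gap to any later value thus contracts by `1 - 1/(4d)` per step, from `d log d` to `d` in about `4d
log log d` steps, after which the constant gain per step allows only `O(d)` more (`exists_rate_lt`).
-/

/-- Hoeffding's lemma for a centred Bernoulli variable. -/
theorem bernoulli_mgf_le {q : ℝ} (hq0 : 0 ≤ q) (hq1 : q ≤ 1) (t : ℝ) :
    (1 - q) * Real.exp (t * (0 - q)) + q * Real.exp (t * (1 - q)) ≤ Real.exp (t ^ 2 / 8) := by
  -- The two-point law as a measure on `ℝ`, so that the sub-Gaussian bound for variables in `[0, 1]`
  -- applies.
  let μ : MeasureTheory.Measure ℝ :=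
    ENNReal.ofReal (1 - q) • MeasureTheory.Measure.dirac 0 +
      ENNReal.ofReal q • MeasureTheory.Measure.dirac 1
  have hint : ∀ f : ℝ → ℝ, ∫ x, f x ∂μ = (1 - q) * f 0 + q * f 1 := by
    intro f
    have hi : ∀ (c a : ℝ), MeasureTheory.Integrable f
        (ENNReal.ofReal c • MeasureTheory.Measure.dirac a) := fun c a =>
      (MeasureTheory.integrable_dirac (by simp)).smul_measure ENNReal.ofReal_ne_top
    rw [MeasureTheory.integral_add_measure (hi _ _) (hi _ _)]
    simp [hq0, hq1]
  have : MeasureTheory.IsProbabilityMeasure μ := ⟨by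
    simp [μ, ← ENNReal.ofReal_add (sub_nonneg.2 hq1) hq0]⟩
  have hb : ∀ᵐ x ∂μ, (fun x : ℝ => x) x ∈ Set.Icc (0 : ℝ) 1 := by
    refine MeasureTheory.ae_add_measure_iff.2 ⟨?_, ?_⟩ <;>
      exact MeasureTheory.Measure.ae_smul_measure (by simp [MeasureTheory.ae_dirac_eq]) _
  have h := (ProbabilityTheory.hasSubgaussianMGF_of_mem_Icc
    (X := fun x : ℝ => x) aemeasurable_id hb).mgf_le t
  rw [ProbabilityTheory.mgf, hint, hint] at h
  refine le_of_eq_of_le (by ring_nf) (h.trans (le_of_eq ?_))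
  congr 1
  simp
  ring

/-! ### Query counts, expectations and concentration for programs. -/

namespace GenProg

variable {S A β δ : Type}

/-- Every output that can be reached when the rewards come from `M` satisfies `p`. -/
def Surely (M : MDP S A) : GenProg S A β → (β → Prop) → Prop
  | ret b, p => p b
  | query s a k, p => ∀ s', (k (M.r s a) s').Surely M p

theorem Surely.of_forall {M : MDP S A} {p : GenProg S A β} {φ : β → Prop} (h : ∀ b, φ b) :
    p.Surely M φ := by
  induction p with
  | ret b => exact h b
  | query s a k ih => exact fun s' => ih _ s'

theorem Surely.mono {M : MDP S A} {p : GenProg S A β} {φ ψ : β → Prop} (h : ∀ b, φ b → ψ b)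
    (hp : p.Surely M φ) : p.Surely M ψ := by
  induction p with
  | ret b => exact h b hp
  | query s a k ih => exact fun s' => ih _ s' (hp s')

theorem surely_bind {M : MDP S A} {p : GenProg S A β} {f : β → GenProg S A δ} {φ : δ → Prop} :
    (p.bind f).Surely M φ ↔ p.Surely M (fun b => (f b).Surely M φ) := by
  induction p with
  | ret b => rfl
  | query s a k ih => exact forall_congr' fun s' => ih _ s'

theorem surely_map {M : MDP S A} {p : GenProg S A β} {f : β → δ} {φ : δ → Prop} :
    (p.map f).Surely M φ ↔ p.Surely M (fun b => φ (f b)) :=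
  surely_bind

theorem QueriesExactly.bind {p : GenProg S A β} {f : β → GenProg S A δ} {N N' : ℕ}
    (hp : p.QueriesExactly N) (hf : ∀ b, (f b).QueriesExactly N') :
    (p.bind f).QueriesExactly (N + N') := by
  induction p generalizing N with
  | ret b =>
    obtain rfl : N = 0 := hp
    rw [zero_add]; exact hf b
  | query s a k ih =>
    obtain ⟨L, rfl, hL⟩ := hp
    exact ⟨L + N', by ring, fun x s' => ih x s' (hL x s')⟩

theorem QueriesExactly.map {p : GenProg S A β} {f : β → δ} {N : ℕ}
    (hp : p.QueriesExactly N) : (p.map f).QueriesExactly N :=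
  hp.bind (N' := 0) fun _ => rfl

theorem queriesExactly_rollout (γ : ℝ) (π : S → A) (n : ℕ) (s : S) (a : A) :
    (rollout γ π n s a).QueriesExactly n := by
  induction n generalizing s a with
  | zero => rfl
  | succ n ih => exact ⟨n, rfl, fun x s' => (ih _ _).map⟩

theorem QueriesExactly.sumRuns {p : GenProg S A ℝ} {N : ℕ} (hp : p.QueriesExactly N) (m : ℕ) :
    (p.sumRuns m).QueriesExactly (m * N) := by
  induction m with
  | zero => exact zero_mul N
  | succ m ih =>
    rw [show (m + 1) * N = N + m * N by ring]
    exact hp.bind fun x => ih.map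

theorem queriesExactly_tabulate {p : S × A → GenProg S A ℝ} {N : ℕ}
    (hp : ∀ c, (p c).QueriesExactly N) (l : List (S × A)) :
    (tabulate p l).QueriesExactly (l.length * N) := by
  induction l with
  | nil => exact zero_mul N
  | cons c l ih =>
    rw [List.length_cons, show (l.length + 1) * N = N + l.length * N by ring]
    exact (hp c).bind fun x => ih.map

theorem queriesExactly_approxPolicyIteration [Fintype S] [Fintype A] {d : ℕ} (γ : ℝ)
    (Φ : Matrix (S × A) (Fin d) ℝ) (ρ : S × A → ℝ) (greedy : (S × A → ℝ) → S → A) (m n k : ℕ)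
    (π : S → A) :
    (approxPolicyIteration γ Φ ρ greedy m n k π).QueriesExactly
      (k * m * n * (coreSet ρ).card) := by
  induction k generalizing π with
  | zero => simp [approxPolicyIteration, QueriesExactly]
  | succ k ih =>
    have h : (estimateQ γ ρ m n π).QueriesExactly ((coreSet ρ).toList.length * (m * n)) :=
      queriesExactly_tabulate (fun c => ((queriesExactly_rollout γ π n c.1 c.2).sumRuns m).map) _
    rw [Finset.length_toList] at h
    rw [show (k + 1) * m * n * (coreSet ρ).card =
      (coreSet ρ).card * (m * n) + k * m * n * (coreSet ρ).card by ring]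
    exact h.bind fun q => ih (greedy (lsExtension Φ ρ q))

variable [Fintype S]

/-- The expectation of `f` at the output when queries are answered by `M`. -/
noncomputable def expect (M : MDP S A) : GenProg S A β → (β → ℝ) → ℝ
  | ret b, f => f b
  | query s a k, f => ∑ s', (M.P s a s').toReal * (k (M.r s a) s').expect M f

theorem _root_.MDP.sum_toReal (M : MDP S A) (s : S) (a : A) :
    ∑ s', (M.P s a s').toReal = 1 := by
  rw [← ENNReal.toReal_sum fun s' _ => PMF.apply_ne_top _ _, ← tsum_fintype (L := .unconditional S),
    PMF.tsum_coe, ENNReal.toReal_one]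

variable (M : MDP S A)

/-- Asking for the comparison on reachable outputs only is essential: returns of roll-outs are
bounded when the rewards come from `M`, but not for arbitrary real answers. -/
theorem expect_mono {p : GenProg S A β} {f g : β → ℝ} (h : p.Surely M (fun b => f b ≤ g b)) :
    p.expect M f ≤ p.expect M g := by
  induction p with
  | ret b => exact h
  | query s a k ih =>
    exact Finset.sum_le_sum fun s' _ =>
      mul_le_mul_of_nonneg_left (ih _ s' (h s')) ENNReal.toReal_nonneg

theorem expect_const (p : GenProg S A β) (x : ℝ) : p.expect M (fun _ => x) = x := by
  induction p with
  | ret b => rfl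
  | query s a k ih => simp only [expect, ih, ← Finset.sum_mul, M.sum_toReal, one_mul]

theorem expect_add (p : GenProg S A β) (f g : β → ℝ) :
    p.expect M (fun b => f b + g b) = p.expect M f + p.expect M g := by
  induction p with
  | ret b => rfl
  | query s a k ih => simp only [expect, ih, ← Finset.sum_add_distrib, mul_add]

theorem expect_const_mul (p : GenProg S A β) (x : ℝ) (f : β → ℝ) :
    p.expect M (fun b => x * f b) = x * p.expect M f := by
  induction p with
  | ret b => rfl
  | query s a k ih =>
    simp only [expect, ih, Finset.mul_sum]
    exact Finset.sum_congr rfl fun s' _ => by ring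

theorem expect_nonneg (p : GenProg S A β) {f : β → ℝ} (h : ∀ b, 0 ≤ f b) :
    0 ≤ p.expect M f :=
  (expect_const M p 0).symm.le.trans (expect_mono M (.of_forall h))

theorem expect_bind (p : GenProg S A β) (f : β → GenProg S A δ) (g : δ → ℝ) :
    (p.bind f).expect M g = p.expect M (fun b => (f b).expect M g) := by
  induction p with
  | ret b => rfl
  | query s a k ih => exact Finset.sum_congr rfl fun s' _ => congrArg _ (ih _ s')

theorem expect_map (p : GenProg S A β) (f : β → δ) (g : δ → ℝ) :
    (p.map f).expect M g = p.expect M (fun b => g (f b)) :=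
  expect_bind M p _ g

/-- The bridge from `PMF` to finite real sums: failure probabilities are handled throughout as
`expect` of an indicator. -/
theorem prob_eq_ofReal_expect (p : GenProg S A β) (E : Set β) :
    p.prob M E = ENNReal.ofReal (p.expect M (E.indicator 1)) := by
  unfold prob
  induction p with
  | ret b => by_cases h : b ∈ E <;> simp [run, expect, h]
  | query s a k ih =>
    simp only [run, expect, PMF.toOuterMeasure_bind_apply, tsum_fintype, ih]
    rw [ENNReal.ofReal_sum_of_nonneg fun s' _ => mul_nonneg ENNReal.toReal_nonneg
      (expect_nonneg M _ (f := E.indicator 1) (Set.indicator_nonneg fun _ _ => zero_le_one))]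
    refine Finset.sum_congr rfl fun s' _ => ?_
    rw [ENNReal.ofReal_mul ENNReal.toReal_nonneg, ENNReal.ofReal_toReal (PMF.apply_ne_top _ _)]

theorem one_sub_le_prob (p : GenProg S A β) (E : Set β) {x : ℝ}
    (h : p.expect M (Eᶜ.indicator 1) ≤ x) : ENNReal.ofReal (1 - x) ≤ p.prob M E := by
  rw [prob_eq_ofReal_expect]
  refine ENNReal.ofReal_le_ofReal ?_
  have h1 : p.expect M (E.indicator 1) + p.expect M (Eᶜ.indicator 1) = 1 := by
    rw [← expect_add, ← expect_const M p 1]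
    congr 1
    ext b
    exact congrFun (Set.indicator_self_add_compl E (1 : β → ℝ)) b
  linarith

/-- By convexity the exponential lies below its chord over `[0, b]`, so the worst law with a given
mean sits on the two endpoints; rescaling by `b` reduces this to `bernoulli_mgf_le`. -/
theorem expect_exp_le {p : GenProg S A ℝ} {b : ℝ} (hb : 0 < b)
    (hp : p.Surely M (fun x => x ∈ Set.Icc 0 b)) (t : ℝ) :
    p.expect M (fun x => Real.exp (t * (x - p.expect M id))) ≤ Real.exp (t ^ 2 * b ^ 2 / 8) := by
  have hq0 : 0 ≤ p.expect M id :=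
    (expect_const M p 0).symm.le.trans (expect_mono M (hp.mono fun x hx => hx.1))
  have hq1 : p.expect M id ≤ b :=
    (expect_mono M (hp.mono fun x hx => hx.2)).trans (expect_const M p b).le
  set μ := p.expect M id
  have h1 : ∀ x ∈ Set.Icc 0 b, Real.exp (t * (x - μ)) ≤
      Real.exp (t * (0 - μ)) +
        ((Real.exp (t * (b - μ)) - Real.exp (t * (0 - μ))) / b) * id x := by
    intro x hx
    have h := convexOn_exp.2 (Set.mem_univ (t * (0 - μ))) (Set.mem_univ (t * (b - μ)))
      (sub_nonneg.2 (div_le_one_of_le₀ hx.2 hb.le)) (div_nonneg hx.1 hb.le) (by ring)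
    simp only [smul_eq_mul] at h
    refine (le_of_eq ?_).trans (h.trans (le_of_eq ?_))
    · congr 1; field_simp; ring
    · simp only [id]; field_simp; ring
  refine (expect_mono M (hp.mono h1)).trans ?_
  rw [expect_add, expect_const, expect_const_mul]
  have h2 := bernoulli_mgf_le (div_nonneg hq0 hb.le) (div_le_one_of_le₀ hq1 hb.le) (t * b)
  rw [show t * b * (0 - μ / b) = t * (0 - μ) by field_simp; ring,
    show t * b * (1 - μ / b) = t * (b - μ) by field_simp, mul_pow] at h2
  refine (le_of_eq ?_).trans h2
  change _ + _ * μ = _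
  field_simp
  ring

/-- Successive runs do not see each other's outputs, so the exponential moment factorises. -/
theorem expect_sumRuns_exp (p : GenProg S A ℝ) (t μ : ℝ) (m : ℕ) :
    (p.sumRuns m).expect M (fun y => Real.exp (t * (y - m * μ))) =
      (p.expect M (fun x => Real.exp (t * (x - μ)))) ^ m := by
  induction m with
  | zero => simp [sumRuns, expect]
  | succ m ih =>
    simp only [sumRuns, expect_bind, expect_map]
    have h : ∀ x y : ℝ, Real.exp (t * (x + y - (m + 1 : ℕ) * μ)) =
        Real.exp (t * (x - μ)) * Real.exp (t * (y - m * μ)) := fun x y => by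
      rw [← Real.exp_add]; push_cast; ring_nf
    simp only [h, expect_const_mul, ih]
    simp only [mul_comm _ ((p.expect M fun x => Real.exp (t * (x - μ))) ^ m), expect_const_mul]
    rw [pow_succ]

/-- Hoeffding's inequality for the average of independent runs of a program. -/
theorem expect_average_le {p : GenProg S A ℝ} {b ε : ℝ} (hb : 0 < b) (hε : 0 < ε)
    (hp : p.Surely M (fun x => x ∈ Set.Icc 0 b)) {m : ℕ} (hm : 0 < m) :
    (p.average m).expect M ({x | |x - p.expect M id| ≤ ε}ᶜ.indicator 1) ≤
      2 * Real.exp (-(2 * m * ε ^ 2 / b ^ 2)) := by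
  have hm' : (0 : ℝ) < m := Nat.cast_pos.2 hm
  set μ := p.expect M id with hμ
  -- The minimiser of the Chernoff exponent `-tmε + mt²b²/8`.
  set t := 4 * ε / b ^ 2 with ht
  have ht0 : 0 < t := by positivity
  have key : ∀ u : ℝ, u ^ 2 = t ^ 2 →
      (p.sumRuns m).expect M (fun y => Real.exp (u * (y - m * μ))) ≤
        Real.exp (m * (t ^ 2 * b ^ 2 / 8)) := fun u hu => by
    rw [expect_sumRuns_exp, Real.exp_nat_mul, ← hu]
    exact pow_le_pow_left₀ (expect_nonneg M _ fun _ => (Real.exp_pos _).le)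
      (expect_exp_le M hb hp u) m
  rw [average, expect_map]
  -- One exponential for each tail.
  have h1 : ∀ y : ℝ, ({x | |x - μ| ≤ ε}ᶜ.indicator 1 : ℝ → ℝ) (y / m) ≤
      Real.exp (-(t * m * ε)) *
        (Real.exp (t * (y - m * μ)) + Real.exp (-t * (y - m * μ))) := by
    intro y
    by_cases h : |y / m - μ| ≤ ε
    · rw [Set.indicator_of_notMem (by simpa using h)]
      positivity
    · rw [Set.indicator_of_mem (by simpa using h), Pi.one_apply, mul_add, ← Real.exp_add,
        ← Real.exp_add]
      have h2 : t * m * (y / m - μ) = t * (y - m * μ) := by field_simp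
      have htm : 0 < t * m := by positivity
      rcases lt_abs.1 (not_le.1 h) with h | h
      · have : 1 ≤ Real.exp (-(t * m * ε) + t * (y - m * μ)) := Real.one_le_exp (by nlinarith)
        linarith [Real.exp_pos (-(t * m * ε) + -t * (y - m * μ))]
      · have : 1 ≤ Real.exp (-(t * m * ε) + -t * (y - m * μ)) := Real.one_le_exp (by nlinarith)
        linarith [Real.exp_pos (-(t * m * ε) + t * (y - m * μ))]
  refine (expect_mono M (.of_forall h1)).trans ?_
  rw [expect_const_mul, expect_add]
  calc _ ≤ Real.exp (-(t * m * ε)) * (2 * Real.exp (m * (t ^ 2 * b ^ 2 / 8))) :=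
        mul_le_mul_of_nonneg_left (by linarith [key t rfl, key (-t) (neg_sq t)])
          (Real.exp_pos _).le
    _ = 2 * Real.exp (-(2 * m * ε ^ 2 / b ^ 2)) := by
      rw [mul_left_comm, ← Real.exp_add, ht]
      congr 2
      field_simp
      ring

-- A union bound over the list. Without repetitions, the update at the head leaves the entries of
-- the tail untouched.
open Classical in
theorem expect_tabulate_le (p : S × A → GenProg S A ℝ) (good : S × A → Set ℝ)
    {l : List (S × A)} (hl : l.Nodup) {x : ℝ}
    (h : ∀ c ∈ l, (p c).expect M ((good c)ᶜ.indicator 1) ≤ x) :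
    (tabulate p l).expect M ({q | ∀ c ∈ l, q c ∈ good c}ᶜ.indicator 1) ≤ l.length * x := by
  induction l with
  | nil => simp [tabulate, expect]
  | cons c l ih =>
    obtain ⟨hc, hl⟩ := List.nodup_cons.1 hl
    simp only [tabulate, expect_bind, expect_map]
    have key : ∀ (y : ℝ) (q : S × A → ℝ),
        ({q | ∀ c' ∈ c :: l, q c' ∈ good c'}ᶜ.indicator 1 : (S × A → ℝ) → ℝ)
          (Function.update q c y) ≤ ((good c)ᶜ.indicator 1 : ℝ → ℝ) y +
            ({q | ∀ c' ∈ l, q c' ∈ good c'}ᶜ.indicator 1 : (S × A → ℝ) → ℝ) q := by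
      intro y q
      have n1 : 0 ≤ ((good c)ᶜ.indicator 1 : ℝ → ℝ) y :=
        Set.indicator_nonneg (fun _ _ => zero_le_one) _
      have n2 : 0 ≤ ({q | ∀ c' ∈ l, q c' ∈ good c'}ᶜ.indicator 1 : (S × A → ℝ) → ℝ) q :=
        Set.indicator_nonneg (fun _ _ => zero_le_one) _
      by_cases hy : y ∈ good c
      · by_cases hq : ∀ c' ∈ l, q c' ∈ good c'
        · rw [Set.indicator_of_notMem]
          · exact add_nonneg n1 n2
          · simp only [Set.mem_compl_iff, Set.mem_ofPred_eq, not_not, List.forall_mem_cons,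
              Function.update_self]
            refine ⟨hy, fun c' hc' => ?_⟩
            rw [Function.update_of_ne (ne_of_mem_of_not_mem hc' hc)]
            exact hq c' hc'
        · rw [Set.indicator_of_mem (s := {q : S × A → ℝ | ∀ c' ∈ l, q c' ∈ good c'}ᶜ) hq]
          exact (Set.indicator_le_self' (fun _ _ => zero_le_one) _).trans
            (le_add_of_nonneg_left n1)
      · rw [Set.indicator_of_mem (s := (good c)ᶜ) hy]
        exact (Set.indicator_le_self' (fun _ _ => zero_le_one) _).trans
          (le_add_of_nonneg_right n2)
    calc _ ≤ (p c).expect M (fun y => (tabulate p l).expect M (fun q =>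
          ((good c)ᶜ.indicator 1 : ℝ → ℝ) y +
            ({q | ∀ c' ∈ l, q c' ∈ good c'}ᶜ.indicator 1 : (S × A → ℝ) → ℝ) q)) :=
          expect_mono M (.of_forall fun y => expect_mono M (.of_forall fun q => key y q))
      _ = (p c).expect M ((good c)ᶜ.indicator 1) + (tabulate p l).expect M
            ({q | ∀ c' ∈ l, q c' ∈ good c'}ᶜ.indicator 1) := by
          simp only [expect_add, expect_const]
      _ ≤ x + l.length * x := add_le_add (h c (by simp))
          (ih hl fun c' hc' => h c' (List.mem_cons_of_mem _ hc'))
      _ = _ := by push_cast [List.length_cons]; ring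

omit [Fintype S] in
theorem surely_rollout (π : S → A) (n : ℕ) (s : S) (a : A) :
    (rollout M.γ π n s a).Surely M (fun x => x ∈ Set.Icc 0 (1 / (1 - M.γ))) := by
  have hγ0 := M.γ_mem.1
  have hγ : 0 < 1 - M.γ := sub_pos.2 M.γ_mem.2
  induction n generalizing s a with
  | zero => exact ⟨le_rfl, by positivity⟩
  | succ n ih =>
    intro s'
    refine surely_map.2 ((ih s' (π s')).mono fun x hx => ?_)
    have h1 := mul_le_mul_of_nonneg_left hx.2 hγ0.le
    have h2 : 1 + M.γ * (1 / (1 - M.γ)) = 1 / (1 - M.γ) := by field_simp; ring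
    exact ⟨add_nonneg (M.r_mem s a).1 (mul_nonneg hγ0.le hx.1), by linarith [(M.r_mem s a).2]⟩

/-- Conditioning on the first transition shifts the discounted series by one term, so the only bias
of a roll-out is its truncation. -/
theorem expect_rollout (π : S → A) (n : ℕ) (s : S) (a : A) :
    (rollout M.γ π n s a).expect M id =
      ∑ t ∈ Finset.range n, M.γ ^ t * M.expectedReward π t (s, a) := by
  induction n generalizing s a with
  | zero => rfl
  | succ n ih =>
    have h : ∀ s', ((rollout M.γ π n s' (π s')).map (fun R => M.r s a + M.γ * R)).expect M id =
        M.r s a + M.γ * ∑ t ∈ Finset.range n, M.γ ^ t * M.expectedReward π t (s', π s') :=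
      fun s' => by
        rw [← ih, expect_map]
        simp only [id]
        rw [expect_add, expect_const, expect_const_mul]
        rfl
    simp only [rollout, expect, h, mul_add, Finset.sum_add_distrib, ← Finset.sum_mul,
      M.sum_toReal, one_mul]
    rw [Finset.sum_range_succ', add_comm]
    congr 1
    · simp only [Finset.mul_sum]
      rw [Finset.sum_comm]
      refine Finset.sum_congr rfl fun t _ => ?_
      simp only [MDP.expectedReward, Function.iterate_succ_apply', MDP.transOp]
      rw [Finset.mul_sum]
      exact Finset.sum_congr rfl fun s' _ => by ring
    · simp [MDP.expectedReward]

end GenProg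

/-! ### Value functions and one greedy improvement step. -/

namespace MDP

variable {S A : Type} [Fintype S] (M : MDP S A)

omit [Fintype S] in
theorem one_sub_γ_pos : 0 < 1 - M.γ := sub_pos.2 M.γ_mem.2

theorem expectedReward_mem_Icc (π : S → A) (t : ℕ) (x : S × A) :
    M.expectedReward π t x ∈ Set.Icc (0 : ℝ) 1 := by
  induction t generalizing x with
  | zero => exact M.r_mem x.1 x.2
  | succ t ih =>
    simp only [expectedReward, Function.iterate_succ_apply', transOp] at ih ⊢
    refine ⟨Finset.sum_nonneg fun s' _ => mul_nonneg ENNReal.toReal_nonneg (ih _).1, ?_⟩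
    rw [← M.sum_toReal x.1 x.2]
    exact Finset.sum_le_sum fun s' _ => mul_le_of_le_one_right ENNReal.toReal_nonneg (ih _).2

theorem pow_mul_expectedReward_mem_Icc (π : S → A) (t : ℕ) (x : S × A) :
    M.γ ^ t * M.expectedReward π t x ∈ Set.Icc (0 : ℝ) (M.γ ^ t) := by
  have h := M.expectedReward_mem_Icc π t x
  have hγ := pow_nonneg M.γ_mem.1.le t
  exact ⟨mul_nonneg hγ h.1, mul_le_of_le_one_right hγ h.2⟩

theorem summable_Qval (π : S → A) (x : S × A) :
    Summable fun t : ℕ => M.γ ^ t * M.expectedReward π t x :=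
  .of_nonneg_of_le (fun t => (M.pow_mul_expectedReward_mem_Icc π t x).1)
    (fun t => (M.pow_mul_expectedReward_mem_Icc π t x).2)
    (summable_geometric_of_lt_one M.γ_mem.1.le M.γ_mem.2)

/-- The truncation error of the discounted sum of the first `n` expected rewards. -/
theorem abs_sum_range_sub_Qval_le (π : S → A) (n : ℕ) (x : S × A) :
    |∑ t ∈ Finset.range n, M.γ ^ t * M.expectedReward π t x - M.Qval π x| ≤
      M.γ ^ n / (1 - M.γ) := by
  have hs := M.summable_Qval π x
  have hg := summable_geometric_of_lt_one M.γ_mem.1.le M.γ_mem.2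
  have h0 := fun t => (M.pow_mul_expectedReward_mem_Icc π t x).1
  rw [Qval, ← hs.sum_add_tsum_nat_add n, sub_add_cancel_left, abs_neg,
    abs_of_nonneg (tsum_nonneg fun t => h0 _)]
  calc _ ≤ ∑' t : ℕ, M.γ ^ (t + n) :=
        ((summable_nat_add_iff n).2 hs).tsum_le_tsum
          (fun t => (M.pow_mul_expectedReward_mem_Icc π _ x).2) ((summable_nat_add_iff n).2 hg)
    _ = _ := by
      simp only [pow_add, tsum_mul_right, tsum_geometric_of_lt_one M.γ_mem.1.le M.γ_mem.2]
      ring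

theorem Qval_nonneg (π : S → A) (x : S × A) : 0 ≤ M.Qval π x :=
  tsum_nonneg fun t => (M.pow_mul_expectedReward_mem_Icc π t x).1

theorem Qval_le (π : S → A) (x : S × A) : M.Qval π x ≤ 1 / (1 - M.γ) := by
  simpa [abs_of_nonneg (M.Qval_nonneg π x)] using M.abs_sum_range_sub_Qval_le π 0 x

/-- The Bellman equation. -/
theorem Qval_eq (π : S → A) (x : S × A) :
    M.Qval π x = M.r x.1 x.2 + M.γ * ∑ s', (M.P x.1 x.2 s').toReal * M.V π s' := by
  rw [Qval, (M.summable_Qval π x).tsum_eq_zero_add]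
  congr 1
  · simp [expectedReward]
  · simp only [V, Qval, ← tsum_mul_left]
    rw [← Summable.tsum_finsetSum fun s' _ => (M.summable_Qval π _).mul_left _, ← tsum_mul_left]
    refine tsum_congr fun t => ?_
    simp only [expectedReward, Function.iterate_succ_apply', transOp, Finset.mul_sum]
    exact Finset.sum_congr rfl fun s' _ => by ring

/-- The `γ`-contraction of the Bellman equation, in one-sided form: transition probabilities average
the differences of `V`. -/
theorem Qval_sub_Qval_le {π σ : S → A} {B : ℝ} (h : ∀ s, M.V σ s - M.V π s ≤ B) (x : S × A) :
    M.Qval σ x - M.Qval π x ≤ M.γ * B := by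
  have h1 : ∑ s', (M.P x.1 x.2 s').toReal * M.V σ s' -
      ∑ s', (M.P x.1 x.2 s').toReal * M.V π s' ≤ B := by
    rw [← Finset.sum_sub_distrib, ← one_mul B, ← M.sum_toReal x.1 x.2, Finset.sum_mul]
    refine Finset.sum_le_sum fun s' _ => ?_
    rw [← mul_sub]
    exact mul_le_mul_of_nonneg_left (h s') ENNReal.toReal_nonneg
  rw [M.Qval_eq σ, M.Qval_eq π]
  linarith [mul_le_mul_of_nonneg_left h1 M.γ_mem.1.le]

/-- One step of approximate policy iteration, compared with an arbitrary policy `σ`. -/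
theorem V_sub_V_greedy_le {π π' σ : S → A} {Q : S × A → ℝ} {η B : ℝ}
    (hQ : ∀ x, |Q x - M.Qval π x| ≤ η) (hg : ∀ s a, Q (s, a) ≤ Q (s, π' s))
    (hB : ∀ s, M.V σ s - M.V π s ≤ B) (s : S) :
    M.V σ s - M.V π' s ≤ M.γ * B + 2 * η / (1 - M.γ) := by
  have hγ := M.one_sub_γ_pos
  -- Passing from `Q^π` to `Q` and back costs `η` each way.
  have hgr : ∀ s a, M.Qval π (s, a) ≤ M.Qval π (s, π' s) + 2 * η := fun s a => by
    linarith [abs_le.1 (hQ (s, a)), abs_le.1 (hQ (s, π' s)), hg s a]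
  have : Nonempty S := ⟨s⟩
  -- At a state where `V^π - V^π'` is largest, this difference `x` satisfies `x ≤ 2η + γx`, which
  -- bounds the loss from one improvement step.
  obtain ⟨s₀, hs₀⟩ := Finite.exists_max fun s => M.V π s - M.V π' s
  have h1 := M.Qval_sub_Qval_le hs₀
  have h2 : M.V π s₀ - M.V π' s₀ ≤ 2 * η / (1 - M.γ) := by
    rw [le_div_iff₀ hγ]
    have h3 := hgr s₀ (π s₀)
    have h4 := h1 (s₀, π' s₀)
    unfold V at h4 ⊢
    linarith
  -- The difference telescopes through `Q^π(s, σ(s))` and `Q^π(s, π'(s))`, with the three pieces at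
  -- most `γB`, `2η` and `γ · 2η/(1-γ)`.
  have h3 := mul_le_mul_of_nonneg_left h2 M.γ_mem.1.le
  have h4 := hgr s (σ s)
  have h5 := h1 (s, π' s)
  have h6 := M.Qval_sub_Qval_le hB (s, σ s)
  have h7 : 2 * η / (1 - M.γ) = 2 * η + M.γ * (2 * η / (1 - M.γ)) := by field_simp; ring
  rw [V, V, h7]
  linarith

end MDP

/-! ### Error amplification of least squares on a design. -/

section Design

variable {ι : Type} [Fintype ι] {d : ℕ} (Φ : Matrix ι (Fin d) ℝ) (ρ : ι → ℝ)

theorem mem_coreSet {i : ι} : i ∈ coreSet ρ ↔ ρ i ≠ 0 := by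
  simp [coreSet]

theorem sum_coreSet {E : Type*} [AddCommMonoid E] {f : ι → E} (h : ∀ i, ρ i = 0 → f i = 0) :
    ∑ i ∈ coreSet ρ, f i = ∑ i, f i :=
  Finset.sum_subset (Finset.subset_univ _) fun i _ hi =>
    h i (not_not.1 (mt (mem_coreSet ρ).2 hi))

theorem designMatrix_eq_sum : designMatrix Φ ρ = ∑ i, ρ i • Matrix.vecMulVec (Φ i) (Φ i) :=
  sum_coreSet ρ fun i hi => by simp [hi]

theorem designMatrix_mulVec (v : Fin d → ℝ) :
    designMatrix Φ ρ *ᵥ v = ∑ i, (ρ i * (Φ i ⬝ᵥ v)) • Φ i := by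
  rw [designMatrix_eq_sum, Matrix.sum_mulVec]
  refine Finset.sum_congr rfl fun i _ => ?_
  rw [Matrix.smul_mulVec, Matrix.vecMulVec_mulVec, mul_smul]
  simp

theorem dotProduct_designMatrix_mulVec (v : Fin d → ℝ) :
    v ⬝ᵥ (designMatrix Φ ρ *ᵥ v) = ∑ i, ρ i * (Φ i ⬝ᵥ v) ^ 2 := by
  rw [designMatrix_mulVec, dotProduct_sum]
  refine Finset.sum_congr rfl fun i _ => ?_
  rw [dotProduct_smul, dotProduct_comm v, smul_eq_mul]
  ring

theorem transpose_designMatrix : (designMatrix Φ ρ)ᵀ = designMatrix Φ ρ := by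
  simp [designMatrix_eq_sum, Matrix.transpose_sum, Matrix.transpose_vecMulVec]

theorem dotProduct_inv_designMatrix_mulVec (v w : Fin d → ℝ) :
    v ⬝ᵥ ((designMatrix Φ ρ)⁻¹ *ᵥ w) = ((designMatrix Φ ρ)⁻¹ *ᵥ v) ⬝ᵥ w := by
  rw [Matrix.dotProduct_mulVec, ← Matrix.mulVec_transpose, Matrix.transpose_nonsing_inv,
    transpose_designMatrix]

variable {Φ ρ}

theorem le_designG (i : ι) : Φ i ⬝ᵥ ((designMatrix Φ ρ)⁻¹ *ᵥ Φ i) ≤ designG Φ ρ :=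
  le_ciSup (f := fun i : ι => Φ i ⬝ᵥ ((designMatrix Φ ρ)⁻¹ *ᵥ Φ i)) (Set.finite_range _).bddAbove i

theorem lsExtension_mulVec (h : IsUnit (designMatrix Φ ρ).det) (θ : Fin d → ℝ) :
    lsExtension Φ ρ (Φ *ᵥ θ) = Φ *ᵥ θ := by
  rw [lsExtension, sum_coreSet ρ fun i hi => by simp [hi]]
  have h1 : ∑ i, (ρ i * (Φ *ᵥ θ) i) • Φ i = designMatrix Φ ρ *ᵥ θ :=
    (designMatrix_mulVec Φ ρ θ).symm
  rw [h1, Matrix.mulVec_mulVec θ, Matrix.nonsing_inv_mul _ h, Matrix.one_mulVec]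

theorem lsExtension_sub (p q : ι → ℝ) :
    lsExtension Φ ρ (p - q) = lsExtension Φ ρ p - lsExtension Φ ρ q := by
  simp only [lsExtension, ← Matrix.mulVec_sub, ← Finset.sum_sub_distrib, ← sub_smul, ← mul_sub,
    Pi.sub_apply]

/-- With `w = G(ρ)⁻¹Φ(i)`, the extension at `i` is `∑ ρ(j) q(j) ⟨Φ(j), w⟩`. Cauchy–Schwarz in
`L²(ρ)` applies: `q` has norm at most `δ`, and `⟨Φ(·), w⟩` has squared norm `wᵀG(ρ)w =
Φ(i)ᵀG(ρ)⁻¹Φ(i) ≤ 2d`. -/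
theorem IsNearOptimalDesign.abs_lsExtension_le (hρ : IsNearOptimalDesign Φ ρ) {q : ι → ℝ} {δ : ℝ}
    (hδ : 0 ≤ δ) (hq : ∀ i ∈ coreSet ρ, |q i| ≤ δ) (i : ι) :
    |lsExtension Φ ρ q i| ≤ δ * √(2 * d) := by
  set w := (designMatrix Φ ρ)⁻¹ *ᵥ Φ i with hw
  have h1 : lsExtension Φ ρ q i = ∑ j, (√(ρ j) * q j) * (√(ρ j) * (Φ j ⬝ᵥ w)) := by
    rw [lsExtension, sum_coreSet ρ fun i hi => by simp [hi]]
    change Φ i ⬝ᵥ _ = _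
    rw [dotProduct_inv_designMatrix_mulVec, dotProduct_sum]
    refine Finset.sum_congr rfl fun j _ => ?_
    rw [dotProduct_smul, dotProduct_comm, smul_eq_mul, ← hw]
    nth_rw 1 [← Real.mul_self_sqrt (hρ.nonneg j)]
    ring
  have h2 : ∑ j, (√(ρ j) * q j) ^ 2 ≤ δ ^ 2 := by
    rw [← one_mul (δ ^ 2), ← hρ.sum_eq_one, Finset.sum_mul]
    refine Finset.sum_le_sum fun j _ => ?_
    rw [mul_pow, Real.sq_sqrt (hρ.nonneg j)]
    by_cases hj : ρ j = 0
    · simp [hj]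
    · exact mul_le_mul_of_nonneg_left
        (sq_le_sq.2 ((hq j ((mem_coreSet ρ).2 hj)).trans (le_abs_self δ))) (hρ.nonneg j)
  have h3 : ∑ j, (√(ρ j) * (Φ j ⬝ᵥ w)) ^ 2 ≤ 2 * d := by
    simp only [mul_pow, Real.sq_sqrt (hρ.nonneg _)]
    rw [← dotProduct_designMatrix_mulVec, hw, Matrix.mulVec_mulVec,
      Matrix.mul_nonsing_inv _ hρ.isUnit_det, Matrix.one_mulVec, dotProduct_comm]
    exact (le_designG i).trans hρ.designG_le
  have h4 := Finset.sum_mul_sq_le_sq_mul_sq Finset.univ (fun j => √(ρ j) * q j)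
    (fun j => √(ρ j) * (Φ j ⬝ᵥ w))
  rw [← h1] at h4
  refine abs_le_of_sq_le_sq ?_ (by positivity)
  rw [mul_pow, Real.sq_sqrt (by positivity)]
  exact h4.trans (mul_le_mul h2 h3 (Finset.sum_nonneg fun _ _ => sq_nonneg _) (sq_nonneg _))

/-- Least squares on a near-optimal core set loses a factor of order `√d` only. -/
theorem IsNearOptimalDesign.abs_lsExtension_sub_le (hρ : IsNearOptimalDesign Φ ρ) (hd : 0 < d)
    {ε : ℝ} (hε : 0 ≤ ε) {q Q : ι → ℝ} (hQ : Q ∈ hypothesisClass Φ ε)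
    (hq : ∀ i ∈ coreSet ρ, |q i - Q i| ≤ 2 * ε) (i : ι) :
    |lsExtension Φ ρ q i - Q i| ≤ 6 * (ε * √d) := by
  obtain ⟨_, ⟨θ, rfl⟩, e, he, rfl⟩ := hQ
  have he' : ∀ j, |e j| ≤ ε := fun j => abs_le.2 ⟨he.1 j, he.2 j⟩
  -- Least squares reproduces `Φθ` exactly, so only the residual `q - Φθ` is amplified.
  have h1 : ∀ j ∈ coreSet ρ, |(q - Φ *ᵥ θ) j| ≤ 3 * ε := fun j hj => by
    have h2 := hq j hj
    have h3 : (q - Φ *ᵥ θ) j = (q j - (Φ *ᵥ θ + e) j) + e j := by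
      simp only [Pi.add_apply, Pi.sub_apply]; ring
    rw [h3]
    exact (abs_add_le _ _).trans (by linarith [he' j])
  have h2 := hρ.abs_lsExtension_le (by positivity) h1 i
  rw [lsExtension_sub, lsExtension_mulVec hρ.isUnit_det] at h2
  have h3 : lsExtension Φ ρ q i - (Φ *ᵥ θ + e) i =
      (lsExtension Φ ρ q - Φ *ᵥ θ) i - e i := by
    simp only [Pi.add_apply, Pi.sub_apply]; ring
  have h4 : (1 : ℝ) ≤ √d := Real.one_le_sqrt.2 (Nat.one_le_cast.2 hd)
  -- This rounds `3√2` up to `5`; the misspecification `ε ≤ ε√d` supplies the sixth unit.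
  have h5 : √(2 : ℝ) ≤ 5 / 3 := Real.sqrt_le_iff.2 ⟨by norm_num, by norm_num⟩
  rw [Real.sqrt_mul zero_le_two] at h2
  change |lsExtension Φ ρ q i - (Φ *ᵥ θ + e) i| ≤ _
  rw [h3]
  have h6 : 3 * ε * (√2 * √d) ≤ 5 * (ε * √d) := by
    have := mul_le_mul_of_nonneg_left h5 (show 0 ≤ 3 * (ε * √d) by positivity)
    linarith
  have h7 := le_mul_of_one_le_right hε h4
  exact (abs_sub _ _).trans (by linarith [he' i])

end Design

/-! ### Comparison of determinants through a trace. -/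

section DetBound

variable {d : ℕ}

/-- The inequality between the geometric and the arithmetic mean of the eigenvalues. -/
theorem Matrix.PosSemidef.det_le_trace_div_pow {A : Matrix (Fin d) (Fin d) ℝ} (hA : A.PosSemidef)
    (hd : 0 < d) : A.det ≤ (A.trace / d) ^ d := by
  have hd' : (d : ℝ) ≠ 0 := by positivity
  have h := Real.geom_mean_le_arith_mean_weighted Finset.univ (fun _ : Fin d => (d : ℝ)⁻¹)
    hA.1.eigenvalues (fun _ _ => by positivity) (by simp [hd'])
    (fun i _ => hA.eigenvalues_nonneg i)
  rw [Real.finsetProd_rpow _ _ fun i _ => hA.eigenvalues_nonneg i, ← Finset.mul_sum] at h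
  have h1 : A.det = ∏ i, hA.1.eigenvalues i := by simpa using hA.1.det_eq_prod_eigenvalues
  have h2 : A.trace = ∑ i, hA.1.eigenvalues i := by simpa using hA.1.trace_eq_sum_eigenvalues
  rw [← h1, ← h2, inv_mul_eq_div] at h
  calc A.det = (A.det ^ (d : ℝ)⁻¹) ^ d := (Real.rpow_inv_natCast_pow hA.det_nonneg hd.ne').symm
    _ ≤ _ := pow_le_pow_left₀ (Real.rpow_nonneg hA.det_nonneg _) h d

-- Factor `G⁻¹ = BᴴB`. Then `BHBᴴ` is positive semidefinite with determinant `det H / det G` and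
-- trace `tr(G⁻¹H)`, and the mean inequality for its eigenvalues applies.
open scoped MatrixOrder Matrix.Norms.L2Operator in
theorem Matrix.PosDef.det_le_det_mul {G H : Matrix (Fin d) (Fin d) ℝ} (hG : G.PosDef)
    (hH : H.PosSemidef) (hd : 0 < d) : H.det ≤ G.det * ((G⁻¹ * H).trace / d) ^ d := by
  obtain ⟨B, hB⟩ := CStarAlgebra.nonneg_iff_eq_star_mul_self.mp hG.inv.posSemidef.nonneg
  have h1 := (hH.conjTranspose_mul_mul_same Bᴴ).det_le_trace_div_pow hd
  rw [Matrix.conjTranspose_conjTranspose, Matrix.trace_mul_comm, ← Matrix.mul_assoc,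
    Matrix.det_mul, Matrix.det_mul] at h1
  change G⁻¹ = Bᴴ * B at hB
  rw [← hB] at h1
  have h2 : Bᴴ.det * B.det = G.det⁻¹ := by
    rw [← Matrix.det_mul, ← hB, Matrix.det_nonsing_inv, Ring.inverse_eq_inv']
  have h3 : B.det * H.det * Bᴴ.det = G.det⁻¹ * H.det := by rw [← h2]; ring
  rw [h3] at h1
  rwa [inv_mul_le_iff₀ hG.det_pos] at h1

end DetBound

/-! ### The Frank–Wolfe step and its starting design. -/

section Design

variable {ι : Type} [Fintype ι] {d : ℕ} {Φ : Matrix ι (Fin d) ℝ} {ρ ρ' : ι → ℝ}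

theorem posSemidef_designMatrix (hρ : ∀ i, 0 ≤ ρ i) : (designMatrix Φ ρ).PosSemidef := by
  rw [designMatrix_eq_sum]
  refine Matrix.posSemidef_sum _ fun i _ => ?_
  have h := Matrix.posSemidef_vecMulVec_self_star (Φ i)
  rw [star_trivial] at h
  exact h.smul (hρ i)

theorem posDef_designMatrix (hρ : ∀ i, 0 ≤ ρ i) (h : IsUnit (designMatrix Φ ρ).det) :
    (designMatrix Φ ρ).PosDef :=
  (posSemidef_designMatrix hρ).posDef_iff_isUnit.2 ((Matrix.isUnit_iff_isUnit_det _).2 h)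

theorem trace_mul_designMatrix (A : Matrix (Fin d) (Fin d) ℝ) :
    (A * designMatrix Φ ρ).trace = ∑ i, ρ i * (Φ i ⬝ᵥ (A *ᵥ Φ i)) := by
  rw [designMatrix_eq_sum, Matrix.mul_sum, Matrix.trace_sum]
  refine Finset.sum_congr rfl fun i _ => ?_
  rw [Matrix.mul_smul, Matrix.trace_smul, Matrix.mul_vecMulVec, Matrix.trace_vecMulVec,
    dotProduct_comm, smul_eq_mul]

/-- No design improves on the log-determinant of `ρ` by more than `d log(g(ρ) / d)`. -/
theorem log_det_designMatrix_le (hd : 0 < d) (hρ : ∀ i, 0 ≤ ρ i)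
    (h : IsUnit (designMatrix Φ ρ).det) (hρ' : ∀ i, 0 ≤ ρ' i) (hρ'1 : ∑ i, ρ' i = 1)
    (h' : IsUnit (designMatrix Φ ρ').det) (hg : 0 < designG Φ ρ) :
    Real.log (designMatrix Φ ρ').det ≤
      Real.log (designMatrix Φ ρ).det + d * Real.log (designG Φ ρ / d) := by
  have hG := posDef_designMatrix hρ h
  have hH := posDef_designMatrix hρ' h'
  have h1 := hG.det_le_det_mul hH.posSemidef hd
  -- The trace is a `ρ'`-average of the quantities whose maximum is `g(ρ)`.
  have h2 : ((designMatrix Φ ρ)⁻¹ * designMatrix Φ ρ').trace ≤ designG Φ ρ := by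
    rw [trace_mul_designMatrix, ← one_mul (designG Φ ρ), ← hρ'1, Finset.sum_mul]
    exact Finset.sum_le_sum fun i _ => mul_le_mul_of_nonneg_left (le_designG i) (hρ' i)
  have h3 : 0 ≤ ((designMatrix Φ ρ)⁻¹ * designMatrix Φ ρ').trace := by
    rw [trace_mul_designMatrix]
    refine Finset.sum_nonneg fun i _ => mul_nonneg (hρ' i) ?_
    simpa using hG.inv.posSemidef.dotProduct_mulVec_nonneg (Φ i)
  have hd' : (0 : ℝ) < d := Nat.cast_pos.2 hd
  have h4 : (designMatrix Φ ρ').det ≤ (designMatrix Φ ρ).det * (designG Φ ρ / d) ^ d :=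
    h1.trans (mul_le_mul_of_nonneg_left
      (pow_le_pow_left₀ (by positivity) (by gcongr) d) hG.det_pos.le)
  refine (Real.log_le_log hH.det_pos h4).trans (le_of_eq ?_)
  rw [Real.log_mul hG.det_pos.ne' (by positivity), Real.log_pow]

open Classical in
/-- One step of the Frank-Wolfe method: a point is added to the core set. -/
theorem exists_design_step [Nonempty ι] (hd : 0 < d) (hρ : ∀ i, 0 ≤ ρ i) (hρ1 : ∑ i, ρ i = 1)
    (h : IsUnit (designMatrix Φ ρ).det) (hg : 0 ≤ designG Φ ρ) :
    ∃ ρ' : ι → ℝ, (∀ i, 0 ≤ ρ' i) ∧ ∑ i, ρ' i = 1 ∧ IsUnit (designMatrix Φ ρ').det ∧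
      (coreSet ρ').card ≤ (coreSet ρ).card + 1 ∧
      Real.log (designMatrix Φ ρ).det + Real.log (1 + designG Φ ρ / (2 * d)) - 1 / 2 ≤
        Real.log (designMatrix Φ ρ').det := by
  have hd' : (0 : ℝ) < d := Nat.cast_pos.2 hd
  obtain ⟨i₀, hi₀⟩ := exists_eq_ciSup_of_finite
    (f := fun i => Φ i ⬝ᵥ ((designMatrix Φ ρ)⁻¹ *ᵥ Φ i))
  change _ = designG Φ ρ at hi₀
  -- Weight `s` on a worst row gains `log(1 + s g(ρ))` by the matrix determinant lemma, while
  -- renormalising loses `d log(1 + s)`; this `s` caps the loss at `1/2`.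
  set s : ℝ := 1 / (2 * d) with hs
  have hs0 : 0 < s := by positivity
  set ρ' : ι → ℝ := fun i => (1 + s)⁻¹ * (ρ i + if i = i₀ then s else 0) with hρ'
  have hM : designMatrix Φ ρ' =
      (1 + s)⁻¹ • (designMatrix Φ ρ + s • Matrix.vecMulVec (Φ i₀) (Φ i₀)) := by
    simp only [designMatrix_eq_sum, hρ', mul_smul, ← Finset.smul_sum, add_smul,
      Finset.sum_add_distrib, ite_smul, zero_smul, Finset.sum_ite_eq', Finset.mem_univ, if_true]
  have hdet : (designMatrix Φ ρ').det =
      ((1 + s)⁻¹) ^ d * ((designMatrix Φ ρ).det * (1 + s * designG Φ ρ)) := by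
    rw [hM, Matrix.det_smul, Fintype.card_fin]
    congr 1
    have h1 : s • Matrix.vecMulVec (Φ i₀) (Φ i₀) =
        Matrix.replicateCol Unit (s • Φ i₀) * Matrix.replicateRow Unit (Φ i₀) := by
      rw [← Matrix.vecMulVec_eq, Matrix.smul_vecMulVec]
    rw [h1, Matrix.det_add_replicateCol_mul_replicateRow h, ← hi₀, Matrix.mul_assoc,
      ← Matrix.replicateCol_mulVec]
    congr 1
    rw [Matrix.det_unique (n := Unit), Matrix.add_apply, Matrix.one_apply_eq,
      Matrix.replicateRow_mul_replicateCol_apply, Matrix.mulVec_smul, dotProduct_smul, smul_eq_mul]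
  have hpos := (posDef_designMatrix hρ h).det_pos
  have hg' : 0 < 1 + s * designG Φ ρ := by positivity
  refine ⟨ρ', fun i => ?_, ?_, ?_, ?_, ?_⟩
  · have := hρ i
    simp only [hρ']
    split_ifs <;> positivity
  · simp only [hρ', ← Finset.mul_sum, Finset.sum_add_distrib, hρ1, Finset.sum_ite_eq',
      Finset.mem_univ, if_true]
    exact inv_mul_cancel₀ (by positivity)
  · rw [hdet]
    exact IsUnit.mk0 _ (by positivity)
  · refine (Finset.card_le_card (t := insert i₀ (coreSet ρ)) fun i hi => ?_).trans
      (Finset.card_insert_le _ _)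
    rw [mem_coreSet] at hi
    rw [Finset.mem_insert, mem_coreSet]
    by_contra! hc
    exact hi (by simp [hρ', hc.1, hc.2])
  · rw [hdet, Real.log_mul (by positivity) (by positivity),
      Real.log_mul hpos.ne' hg'.ne', Real.log_pow, Real.log_inv]
    have h1 : Real.log (1 + s) ≤ s := by
      linarith [Real.log_le_sub_one_of_pos (show 0 < 1 + s by positivity)]
    have h2 : d * Real.log (1 + s) ≤ 1 / 2 := by
      refine (mul_le_mul_of_nonneg_left h1 hd'.le).trans (le_of_eq ?_)
      rw [hs]; field_simp
    have h3 : designG Φ ρ / (2 * d) = s * designG Φ ρ := by rw [hs]; ring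
    rw [h3]
    linarith

open Classical in
/-- The uniform design on `d` rows of maximal volume. -/
theorem exists_initial_design (hd : 0 < d)
    (hspan : Submodule.span ℝ (Set.range fun i => Φ i) = ⊤) :
    ∃ ρ : ι → ℝ, (∀ i, 0 ≤ ρ i) ∧ ∑ i, ρ i = 1 ∧ IsUnit (designMatrix Φ ρ).det ∧
      (coreSet ρ).card ≤ d ∧ designG Φ ρ ≤ (d : ℝ) ^ 2 := by
  have hd' : (0 : ℝ) < d := Nat.cast_pos.2 hd
  obtain ⟨f₀, hf₀⟩ : ∃ f : Fin d → ι, (Φ.submatrix f id).det ≠ 0 := by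
    obtain ⟨g, hg, -, hli⟩ := Submodule.exists_fun_fin_finrank_span_eq ℝ (Set.range fun i => Φ i)
    have hr : Module.finrank ℝ (Submodule.span ℝ (Set.range fun i => Φ i)) = d := by
      rw [hspan, finrank_top, Module.finrank_fin_fun]
    choose f hf using hg
    refine ⟨fun j => f (Fin.cast hr.symm j), ?_⟩
    rw [← isUnit_iff_ne_zero, ← Matrix.isUnit_iff_isUnit_det,
      ← Matrix.linearIndependent_rows_iff_isUnit]
    have : (Φ.submatrix (fun j => f (Fin.cast hr.symm j)) id).row =
        fun j => g (Fin.cast hr.symm j) := by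
      ext j k
      exact congrFun (hf (Fin.cast hr.symm j)) k
    rw [this]
    exact hli.comp _ (Fin.cast_injective _)
  have : Nonempty ι := ⟨f₀ ⟨0, hd⟩⟩
  -- By Cramer's rule, maximality of the volume gives every row of `Φ` coordinates in `[-1, 1]` with
  -- respect to the chosen rows.
  obtain ⟨f, hf⟩ := Finite.exists_max fun f : Fin d → ι => |(Φ.submatrix f id).det|
  set B := Φ.submatrix f id with hB
  have hB0 : B.det ≠ 0 := abs_pos.1 ((abs_pos.2 hf₀).trans_le (hf f₀))
  set ρ : ι → ℝ := fun i => ∑ j, if f j = i then (d : ℝ)⁻¹ else 0 with hρ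
  have hG : designMatrix Φ ρ = (d : ℝ)⁻¹ • (Bᵀ * B) := by
    rw [designMatrix_eq_sum]
    simp only [hρ, Finset.sum_smul, ite_smul, zero_smul]
    rw [Finset.sum_comm]
    simp only [Finset.sum_ite_eq, Finset.mem_univ, if_true, ← Finset.smul_sum]
    congr 1
    ext a b
    simp [Matrix.sum_apply, Matrix.mul_apply, Matrix.vecMulVec_apply, hB]
  have hdet : IsUnit (designMatrix Φ ρ).det := by
    rw [hG, Matrix.det_smul, Matrix.det_mul, Matrix.det_transpose]
    exact IsUnit.mk0 _ (by positivity)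
  refine ⟨ρ, fun i => ?_, ?_, hdet, ?_, ciSup_le fun i => ?_⟩
  · exact Finset.sum_nonneg fun j _ => by split_ifs <;> positivity
  · simp only [hρ]
    rw [Finset.sum_comm]
    simp [hd'.ne']
  · refine (Finset.card_le_card (t := Finset.univ.image f) fun i hi => ?_).trans
      (Finset.card_image_le.trans (by simp))
    rw [mem_coreSet] at hi
    by_contra hc
    refine hi (Finset.sum_eq_zero fun j _ => if_neg fun h => hc ?_)
    exact Finset.mem_image.2 ⟨j, Finset.mem_univ _, h⟩
  · set c : Fin d → ℝ := B.det⁻¹ • Matrix.cramer Bᵀ (Φ i) with hc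
    have hBc : Bᵀ *ᵥ c = Φ i := by
      rw [hc, Matrix.mulVec_smul, Matrix.mulVec_cramer, Matrix.det_transpose, smul_smul,
        inv_mul_cancel₀ hB0, one_smul]
    have hc1 : ∀ j, c j ^ 2 ≤ 1 := fun j => by
      have h1 : (B.updateRow j (Φ i)) = Φ.submatrix (Function.update f j i) id := by
        ext a b
        by_cases ha : a = j
        · subst ha; simp
        · simp [ha, hB]
      have h2 : |c j| ≤ 1 := by
        rw [hc, Pi.smul_apply, Matrix.cramer_transpose_apply, h1, smul_eq_mul, abs_mul, abs_inv,
          inv_mul_le_iff₀ (abs_pos.2 hB0), mul_one]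
        exact hf _
      exact (sq_le_one_iff_abs_le_one _).2 h2
    have hBu : IsUnit B.det := IsUnit.mk0 _ hB0
    -- Since `G(ρ) = BᵀB/d` and `Φ(i) = Bᵀc`, the quantity to bound is `d‖c‖²`, hence at most `d²`.
    have hinv : (designMatrix Φ ρ)⁻¹ *ᵥ Φ i = (d : ℝ) • (B⁻¹ *ᵥ c) := by
      have h1 : designMatrix Φ ρ *ᵥ ((d : ℝ) • (B⁻¹ *ᵥ c)) = Φ i := by
        rw [hG, Matrix.mulVec_smul, Matrix.smul_mulVec, smul_smul, mul_inv_cancel₀ hd'.ne',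
          one_smul, Matrix.mulVec_mulVec, Matrix.mul_assoc, Matrix.mul_nonsing_inv _ hBu,
          Matrix.mul_one, hBc]
      nth_rw 1 [← h1]
      rw [Matrix.mulVec_mulVec, Matrix.nonsing_inv_mul _ hdet, Matrix.one_mulVec]
    rw [hinv, dotProduct_smul]
    nth_rw 1 [← hBc]
    rw [Matrix.mulVec_transpose, ← Matrix.dotProduct_mulVec, Matrix.mulVec_mulVec,
      Matrix.mul_nonsing_inv _ hBu, Matrix.one_mulVec, smul_eq_mul, sq]
    refine mul_le_mul_of_nonneg_left ?_ hd'.le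
    calc c ⬝ᵥ c ≤ ∑ _j : Fin d, (1 : ℝ) :=
          Finset.sum_le_sum fun j _ => by rw [← sq]; exact hc1 j
      _ = d := by simp

end Design

/-! ### Counting the Frank–Wolfe steps. -/

/-- From `(1 + x/2)² ≥ 2x`; what remains is `3/4 · log 2 ≥ 1/2`. With `x = g(ρ)/d` this is the net
gain of a Frank–Wolfe step. -/
theorem half_add_quarter_log_le {x : ℝ} (hx : 2 ≤ x) :
    1 / 4 * Real.log x ≤ Real.log (1 + x / 2) - 1 / 2 := by
  have h0 : 0 < 1 + x / 2 := by positivity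
  have h1 : Real.log 2 + Real.log x ≤ 2 * Real.log (1 + x / 2) := by
    rw [← Real.log_mul two_ne_zero (by positivity),
      show (2 : ℝ) * Real.log (1 + x / 2) = Real.log ((1 + x / 2) ^ 2) by simp]
    exact Real.log_le_log (by positivity) (by nlinarith [sq_nonneg (1 - x / 2)])
  have h2 := Real.log_le_log two_pos hx
  linarith [Real.log_two_gt_d9]

/-- A potential with gap at most `d log d` that grows at the rate `L` of the gap per unit of `d`
cannot do so for more than of order `d log log d` steps. -/
theorem exists_rate_lt {d : ℕ} (hd : 0 < d) (u L : ℕ → ℝ)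
    (hstep : ∀ j, Real.log 2 ≤ L j → u j + 1 / 4 * L j ≤ u (j + 1))
    (hgap : ∀ i j, Real.log 2 ≤ L j → u i ≤ u j + d * L j) (h0 : L 0 ≤ Real.log d) :
    ∃ j : ℕ, (j : ℝ) ≤ 13 * (d * logPlus (Real.log d)) ∧ L j < Real.log 2 := by
  by_contra! hL
  have hd' : (1 : ℝ) ≤ d := Nat.one_le_cast.2 hd
  have hd0 : (0 : ℝ) < d := by linarith
  have hlp : 1 ≤ logPlus (Real.log d) := le_max_left _ _
  have hdl : (d : ℝ) ≤ d * logPlus (Real.log d) := le_mul_of_one_le_right hd0.le hlp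
  -- Two phases: `J` steps bring the gap down to `d`, then `8d` steps gain `2d log 2 > d`, which is
  -- impossible. Rounding up adds at most `1 ≤ d`, whence `4 + 8 + 1 = 13`.
  set J := ⌈4 * (d * logPlus (Real.log d))⌉₊ with hJ
  have hJ1 : 4 * (d * logPlus (Real.log d)) ≤ J := Nat.le_ceil _
  have hJ2 : (J : ℝ) < 4 * (d * logPlus (Real.log d)) + 1 := Nat.ceil_lt_add_one (by positivity)
  set N := J + 8 * d with hN
  have hN2 : (N : ℝ) ≤ 13 * (d * logPlus (Real.log d)) := by
    rw [hN]; push_cast; linarith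
  have hL' : ∀ j ≤ N, Real.log 2 ≤ L j := fun j hj =>
    hL j ((Nat.cast_le.2 hj).trans hN2)
  have hlog2 := Real.log_two_gt_d9
  have hq0 : 0 ≤ 1 - 1 / (4 * d : ℝ) := sub_nonneg.2 ((div_le_one (by positivity)).2 (by linarith))
  -- The gap is measured to the last potential `u N`, so no maximiser of the determinant is needed.
  have hdecay : ∀ j ≤ N, u N - u j ≤ (1 - 1 / (4 * d : ℝ)) ^ j * (d * Real.log d) := by
    intro j hj
    induction j with
    | zero =>
      have h1 := hgap N 0 (hL' 0 hj)
      have h2 := mul_le_mul_of_nonneg_left h0 hd0.le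
      simp only [pow_zero, one_mul]
      linarith
    | succ j ih =>
      have h1 := ih (by lia)
      have h2 := hL' j (by lia)
      have h3 := hstep j h2
      have h4 := hgap N j h2
      have h5 : (u N - u j) / (4 * d) ≤ 1 / 4 * L j := by
        rw [div_le_iff₀ (by positivity)]
        linarith
      have h6 := mul_le_mul_of_nonneg_left h1 hq0
      have h7 : (1 - 1 / (4 * d : ℝ)) * (u N - u j) = u N - u j - (u N - u j) / (4 * d) := by ring
      rw [pow_succ', mul_assoc]
      linarith
  have hgrow : ∀ t ≤ 8 * d, u J + t * (1 / 4 * Real.log 2) ≤ u (J + t) := by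
    intro t ht
    induction t with
    | zero => simp
    | succ t ih =>
      have h1 := ih (by lia)
      have h2 := hL' (J + t) (by lia)
      have h3 := hstep _ h2
      rw [← add_assoc]
      push_cast
      linarith
  have h1 := hgrow (8 * d) le_rfl
  have h2 := hdecay J (by lia)
  have h3 : (1 - 1 / (4 * d : ℝ)) ^ J * Real.log d ≤ 1 := by
    -- The case `log d = 0` is separate, since `exp(log(log d)) = log d` needs `log d > 0`.
    have hlogd : 0 ≤ Real.log d := Real.log_nonneg hd'
    rcases hlogd.eq_or_lt with h | h
    · rw [← h]; simp
    have h4 : (1 - 1 / (4 * d : ℝ)) ^ J ≤ Real.exp (-Real.log (Real.log d)) := by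
      calc _ ≤ Real.exp (-(1 / (4 * d : ℝ))) ^ J :=
            pow_le_pow_left₀ hq0 (Real.one_sub_le_exp_neg _) J
        _ = Real.exp (-(J / (4 * d))) := by rw [← Real.exp_nat_mul]; congr 1; ring
        _ ≤ _ := by
          refine Real.exp_le_exp.2 (neg_le_neg ?_)
          rw [le_div_iff₀ (by positivity)]
          have : Real.log (Real.log d) ≤ logPlus (Real.log d) := le_max_right _ _
          have := mul_le_mul_of_nonneg_right this (show (0 : ℝ) ≤ 4 * d by positivity)
          linarith
    rw [Real.exp_neg, Real.exp_log h] at h4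
    exact (mul_le_mul_of_nonneg_right h4 h.le).trans (inv_mul_cancel₀ h.ne').le
  have h4 := mul_le_mul_of_nonneg_left h3 hd0.le
  push_cast at h1
  have h5 := mul_lt_mul_of_pos_left (show 0.5 < Real.log 2 by linarith) hd0
  linarith

/-- A near-optimal design with a core set of size of order `d log log d`. -/
theorem exists_isNearOptimalDesign {ι : Type} [Fintype ι] {d : ℕ} {Φ : Matrix ι (Fin d) ℝ}
    (hd : 0 < d) (hspan : Submodule.span ℝ (Set.range fun i => Φ i) = ⊤) :
    ∃ ρ : ι → ℝ, IsNearOptimalDesign Φ ρ ∧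
      ((coreSet ρ).card : ℝ) ≤ 14 * (d * logPlus (Real.log d)) := by
  obtain ⟨ρ₀, h1, h2, h3, h4, h5⟩ := exists_initial_design hd hspan
  have hd0 : (0 : ℝ) < d := Nat.cast_pos.2 hd
  have hne : Nonempty ι := by
    by_contra h
    rw [not_nonempty_iff] at h
    simp at h2
  let D := {ρ : ι → ℝ // (∀ i, 0 ≤ ρ i) ∧ ∑ i, ρ i = 1 ∧ IsUnit (designMatrix Φ ρ).det}
  have hg0 : ∀ ρ : D, 0 ≤ designG Φ ρ.1 := fun ρ => by
    refine le_trans ?_ (le_designG (Classical.arbitrary ι))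
    simpa using (posDef_designMatrix ρ.2.1 ρ.2.2.2).inv.posSemidef.dotProduct_mulVec_nonneg
      (Φ (Classical.arbitrary ι))
  have hnext : ∀ ρ : D, ∃ ρ' : D, (coreSet ρ'.1).card ≤ (coreSet ρ.1).card + 1 ∧
      Real.log (designMatrix Φ ρ.1).det + Real.log (1 + designG Φ ρ.1 / (2 * d)) - 1 / 2 ≤
        Real.log (designMatrix Φ ρ'.1).det := fun ρ => by
    obtain ⟨ρ', a, b, c, e, f⟩ := exists_design_step hd ρ.2.1 ρ.2.2.1 ρ.2.2.2 (hg0 ρ)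
    exact ⟨⟨ρ', a, b, c⟩, e, f⟩
  choose next hcard hdet using hnext
  let σ : ℕ → D := fun j => next^[j] ⟨ρ₀, h1, h2, h3⟩
  have hσ : ∀ j, σ (j + 1) = next (σ j) := fun j => Function.iterate_succ_apply' _ _ _
  have hσcard : ∀ j, (coreSet (σ j).1).card ≤ d + j := fun j => by
    induction j with
    | zero => exact h4
    | succ j ih => rw [hσ]; exact (hcard _).trans (by lia)
  -- The convention `log 0 = 0 < log 2` excludes a vanishing ratio here.
  have hlam : ∀ j, Real.log 2 ≤ Real.log (designG Φ (σ j).1 / d) →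
      2 ≤ designG Φ (σ j).1 / d := fun j hj => by
    rcases (div_nonneg (hg0 (σ j)) hd0.le).eq_or_lt with h | h
    · rw [← h, Real.log_zero] at hj
      linarith [Real.log_two_gt_d9]
    · exact (Real.log_le_log_iff two_pos h).1 hj
  obtain ⟨j, hj, hjL⟩ := exists_rate_lt hd (fun j => Real.log (designMatrix Φ (σ j).1).det)
    (fun j => Real.log (designG Φ (σ j).1 / d))
    (fun j hj => by
      have h6 := half_add_quarter_log_le (hlam j hj)
      have h7 := hdet (σ j)
      rw [div_div, mul_comm (d : ℝ) 2] at h6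
      simp only [hσ]
      linarith)
    (fun i j hj => by
      have h6 := hlam j hj
      rw [le_div_iff₀ hd0] at h6
      exact log_det_designMatrix_le hd (σ j).2.1 (σ j).2.2.2 (σ i).2.1 (σ i).2.2.1 (σ i).2.2.2
        (by linarith))
    (by
      have h6 : designG Φ ρ₀ / d ≤ d := by
        rw [div_le_iff₀ hd0, ← sq]; exact h5
      rcases (div_nonneg (hg0 (σ 0)) hd0.le).eq_or_lt with h | h
      · simp only [← h, Real.log_zero]
        exact Real.log_natCast_nonneg d
      · exact Real.log_le_log h h6)
  refine ⟨(σ j).1, ⟨(σ j).2.1, (σ j).2.2.1, (σ j).2.2.2, ?_⟩, ?_⟩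
  · by_contra! h
    have h6 : 2 ≤ designG Φ (σ j).1 / d := by rw [le_div_iff₀ hd0]; exact h.le
    exact absurd (Real.log_le_log two_pos h6) (not_le.2 hjL)
  · have h6 : ((coreSet (σ j).1).card : ℝ) ≤ d + j := by exact_mod_cast hσcard j
    have h7 : (d : ℝ) ≤ d * logPlus (Real.log d) :=
      le_mul_of_one_le_right hd0.le (le_max_left _ _)
    linarith

/-! ### The parameters `k`, `m` and `n`. -/

/-- Since `γ ≤ exp(-(1-γ))`. Used with `x = ε√d` for the number of iterations and `x = ε(1-γ)` for
the roll-out length. -/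
theorem pow_natCeil_log_le {γ x : ℝ} (hγ0 : 0 ≤ γ) (hγ1 : γ < 1) (hx : 0 < x) :
    γ ^ ⌈Real.log (1 / x) / (1 - γ)⌉₊ ≤ x := by
  set k := ⌈Real.log (1 / x) / (1 - γ)⌉₊
  have h1 : Real.log (1 / x) ≤ k * (1 - γ) := (div_le_iff₀ (sub_pos.2 hγ1)).1 (Nat.le_ceil _)
  calc γ ^ k ≤ Real.exp (-(1 - γ)) ^ k := by
        refine pow_le_pow_left₀ hγ0 ?_ k
        linarith [Real.one_sub_le_exp_neg (1 - γ)]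
    _ = Real.exp (-(k * (1 - γ))) := by rw [← Real.exp_nat_mul]; congr 1; ring
    _ ≤ Real.exp (-Real.log (1 / x)) := Real.exp_le_exp.2 (neg_le_neg h1)
    _ = x := by rw [one_div, Real.log_inv, neg_neg, Real.exp_log hx]

theorem natCeil_le_two_mul_div {x L z : ℝ} (hx : x ≤ L / z) (hL : 1 ≤ L) (hz0 : 0 < z)
    (hz1 : z ≤ 1) : (⌈x⌉₊ : ℝ) ≤ 2 * L / z := by
  have h0 : 0 ≤ L / z := by positivity
  have h1 : (⌈x⌉₊ : ℝ) ≤ ⌈L / z⌉₊ := Nat.cast_le.2 (Nat.ceil_mono hx)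
  have h2 := Nat.ceil_lt_add_one h0
  have h3 : 1 ≤ L / z := (one_le_div hz0).2 (hz1.trans hL)
  have h4 : 2 * L / z = L / z + L / z := by ring
  linarith

theorem one_le_logPlus (x : ℝ) : 1 ≤ logPlus x := le_max_left _ _

theorem log_le_logPlus (x : ℝ) : Real.log x ≤ logPlus x := le_max_right _ _

theorem mul_sqrt_lt_one_of_numIter_pos {d : ℕ} {ε γ : ℝ} (hγ1 : γ < 1) (hx : 0 < ε * √(d : ℝ))
    (hk : 0 < numIter d ε γ) : ε * √(d : ℝ) < 1 := by
  by_contra! h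
  refine hk.ne' (Nat.ceil_eq_zero.2 (div_nonpos_of_nonpos_of_nonneg ?_ (sub_pos.2 hγ1).le))
  exact Real.log_nonpos (by positivity) ((div_le_one hx).2 h)

/-- Either `k = 0` and there is nothing to bound, or `ε√d < 1`, hence `ε < 1`. In the latter case
each of the three ceilings costs at most a factor `2`, whence `8`. -/
theorem numSamples_le {d : ℕ} (hd : 0 < d) {ε γ : ℝ} (hε : 0 < ε) (hγ0 : 0 < γ)
    (hγ1 : γ < 1) (α : ℝ) (c : ℕ) :
    ((numIter d ε γ * numRollouts (numIter d ε γ) c ε γ α * rolloutLength ε γ : ℕ) : ℝ) ≤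
      8 * (logPlus (1 / (ε * (1 - γ))) * logPlus (2 * numIter d ε γ * c / α) *
        logPlus (1 / (ε * √(d : ℝ))) / (ε ^ 2 * (1 - γ) ^ 4)) := by
  have h1γ : 0 < 1 - γ := sub_pos.2 hγ1
  have hL1 := one_le_logPlus (1 / (ε * (1 - γ)))
  have hL2 := one_le_logPlus (2 * numIter d ε γ * c / α)
  have hL3 := one_le_logPlus (1 / (ε * √(d : ℝ)))
  rcases Nat.eq_zero_or_pos (numIter d ε γ) with hk | hk
  · have h0 : ((numIter d ε γ * numRollouts (numIter d ε γ) c ε γ α * rolloutLength ε γ : ℕ) : ℝ)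
        = 0 := by simp [hk]
    rw [h0]
    positivity
  have hs : (1 : ℝ) ≤ √d := Real.one_le_sqrt.2 (Nat.one_le_cast.2 hd)
  have hε1 : ε < 1 := (le_mul_of_one_le_right hε.le hs).trans_lt
    (mul_sqrt_lt_one_of_numIter_pos hγ1 (by positivity) hk)
  have hkb : (numIter d ε γ : ℝ) ≤ 2 * logPlus (1 / (ε * √(d : ℝ))) / (1 - γ) :=
    natCeil_le_two_mul_div (by gcongr; exact log_le_logPlus _) hL3 h1γ (by linarith)
  have hnb : (rolloutLength ε γ : ℝ) ≤ 2 * logPlus (1 / (ε * (1 - γ))) / (1 - γ) :=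
    natCeil_le_two_mul_div (by gcongr; exact log_le_logPlus _) hL1 h1γ (by linarith)
  have hmb : (numRollouts (numIter d ε γ) c ε γ α : ℝ) ≤
      2 * logPlus (2 * numIter d ε γ * c / α) / (ε * (1 - γ)) ^ 2 := by
    refine natCeil_le_two_mul_div ?_ hL2 (by positivity) (pow_le_one₀ (by positivity) ?_)
    · refine (div_le_div_of_nonneg_right (log_le_logPlus _) (by positivity)).trans ?_
      refine div_le_div_of_nonneg_left (by linarith) (by positivity) ?_
      have : 0 ≤ (ε * (1 - γ)) ^ 2 := by positivity
      linarith [mul_pow ε (1 - γ) 2]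
    · exact mul_le_one₀ hε1.le h1γ.le (by linarith)
  push_cast
  refine (mul_le_mul (mul_le_mul hkb hmb (by positivity) (by positivity)) hnb (by positivity)
    (by positivity)).trans (le_of_eq ?_)
  field_simp
  ring

/-- The choice of `m` makes each Hoeffding failure probability at most `α/(kc)`, ready for the union
bound over `k` iterations and `c` core pairs. -/
theorem two_mul_exp_numRollouts_le {k c : ℕ} {ε γ α : ℝ} (hk : 0 < k) (hc : 0 < c) (hε : 0 < ε)
    (hγ1 : γ < 1) (hα : 0 < α) :
    k * (c * (2 * Real.exp (-(2 * numRollouts k c ε γ α * ε ^ 2 / (1 / (1 - γ)) ^ 2)))) ≤ α := by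
  have h1γ : 0 < 1 - γ := sub_pos.2 hγ1
  have hk' : (0 : ℝ) < k := Nat.cast_pos.2 hk
  have hc' : (0 : ℝ) < c := Nat.cast_pos.2 hc
  set m := numRollouts k c ε γ α with hm
  have h1 : Real.log (2 * k * c / α) ≤ m * (2 * ε ^ 2 * (1 - γ) ^ 2) :=
    (div_le_iff₀ (by positivity)).1 (Nat.le_ceil _)
  have h2 : 2 * m * ε ^ 2 / (1 / (1 - γ)) ^ 2 = m * (2 * ε ^ 2 * (1 - γ) ^ 2) := by
    field_simp
  have h3 : Real.exp (-(m * (2 * ε ^ 2 * (1 - γ) ^ 2))) ≤ (2 * k * c / α)⁻¹ := by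
    rw [← Real.exp_log (show 0 < 2 * k * c / α by positivity), ← Real.exp_neg]
    exact Real.exp_le_exp.2 (neg_le_neg h1)
  rw [h2]
  calc _ ≤ k * (c * (2 * (2 * k * c / α)⁻¹)) := by gcongr
    _ = α := by field_simp

theorem numRollouts_pos {k c : ℕ} {ε γ α : ℝ} (hk : 0 < k) (hc : 0 < c) (hε : 0 < ε)
    (hγ1 : γ < 1) (hα0 : 0 < α) (hα1 : α < 1) : 0 < numRollouts k c ε γ α := by
  have h1γ : 0 < 1 - γ := sub_pos.2 hγ1
  have hk' : (1 : ℝ) ≤ k := Nat.one_le_cast.2 hk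
  have hc' : (1 : ℝ) ≤ c := Nat.one_le_cast.2 hc
  refine Nat.ceil_pos.2 (div_pos (Real.log_pos ?_) (by positivity))
  rw [lt_div_iff₀ hα0]
  nlinarith

theorem iterate_affine_le {γ b : ℝ} (hγ0 : 0 ≤ γ) (hγ1 : γ < 1) (hb : 0 ≤ b) (k : ℕ) (B : ℝ) :
    (fun x => γ * x + b)^[k] B ≤ γ ^ k * B + b / (1 - γ) := by
  have h1γ : 0 < 1 - γ := sub_pos.2 hγ1
  induction k with
  | zero =>
    have : 0 ≤ b / (1 - γ) := by positivity
    simp only [Function.iterate_zero, id, pow_zero, one_mul]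
    linarith
  | succ k ih =>
    rw [Function.iterate_succ_apply', pow_succ']
    have h1 := mul_le_mul_of_nonneg_left ih hγ0
    have h2 : b / (1 - γ) = γ * (b / (1 - γ)) + b := by field_simp; ring
    change γ * _ + b ≤ _
    linarith

/-! ### Analysis of approximate policy iteration. -/

namespace GenProg

variable {S A : Type} [Fintype S] [Fintype A] (M : MDP S A) {ρ : S × A → ℝ}

/-- One `ε` is the sampling error around the mean return, the other the truncation error of that
mean. -/
theorem expect_estimateQ_le {ε : ℝ} (hε : 0 < ε) {m n : ℕ} (hm : 0 < m)
    (hn : M.γ ^ n / (1 - M.γ) ≤ ε) (π : S → A) :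
    (estimateQ M.γ ρ m n π).expect M
        ({q | ∀ c ∈ coreSet ρ, |q c - M.Qval π c| ≤ 2 * ε}ᶜ.indicator 1) ≤
      (coreSet ρ).card * (2 * Real.exp (-(2 * m * ε ^ 2 / (1 / (1 - M.γ)) ^ 2))) := by
  let good : S × A → Set ℝ := fun c =>
    {x | |x - (rollout M.γ π n c.1 c.2).expect M id| ≤ ε}
  have h1 := expect_tabulate_le M (fun c => (rollout M.γ π n c.1 c.2).average m) good
    (coreSet ρ).nodup_toList fun c _ => expect_average_le M (one_div_pos.2 M.one_sub_γ_pos) hε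
      (surely_rollout M π n c.1 c.2) hm
  rw [Finset.length_toList] at h1
  refine le_trans (expect_mono M (.of_forall fun q => ?_)) h1
  suffices h : {q : S × A → ℝ | ∀ c ∈ (coreSet ρ).toList, q c ∈ good c} ⊆
      {q | ∀ c ∈ coreSet ρ, |q c - M.Qval π c| ≤ 2 * ε} from
    Set.indicator_le_indicator_of_subset (Set.compl_subset_compl.2 h) (fun _ => zero_le_one) q
  intro q hq c hc
  have h2 : |q c - (rollout M.γ π n c.1 c.2).expect M id| ≤ ε := hq c (Finset.mem_toList.2 hc)
  have h3 := M.abs_sum_range_sub_Qval_le π n c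
  rw [expect_rollout] at h2
  exact (abs_sub_le _ _ _).trans (by linarith)

/-- Each iteration adds at most `β` to the failure probability; as `hβ` covers every policy, the
randomness of the current one is harmless. Comparing with all `σ` at once avoids singling out an
optimal policy. -/
theorem expect_approxPolicyIteration_le {d : ℕ} (hd : 0 < d) {Φ : Matrix (S × A) (Fin d) ℝ}
    {ε β : ℝ} (hε : 0 ≤ ε) (hΦ : ∀ π : S → A, M.Qval π ∈ hypothesisClass Φ ε)
    (hρ : IsNearOptimalDesign Φ ρ) {greedy : (S × A → ℝ) → S → A} (hg : IsGreedySelector greedy)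
    {m n : ℕ} (hβ : ∀ π, (estimateQ M.γ ρ m n π).expect M
        ({q | ∀ c ∈ coreSet ρ, |q c - M.Qval π c| ≤ 2 * ε}ᶜ.indicator 1) ≤ β)
    (k : ℕ) {π : S → A} {B : ℝ} (hB : ∀ σ s, M.V σ s - M.V π s ≤ B) :
    (approxPolicyIteration M.γ Φ ρ greedy m n k π).expect M
        ({π' | ∀ σ s, M.V σ s - M.V π' s ≤
          (fun x => M.γ * x + 2 * (6 * (ε * √d)) / (1 - M.γ))^[k] B}ᶜ.indicator 1) ≤ k * β := by
  induction k generalizing π B with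
  | zero =>
    simp only [approxPolicyIteration, expect, Nat.cast_zero, zero_mul]
    exact (Set.indicator_of_notMem (not_not.2 hB) _).le
  | succ k ih =>
    have hβ0 : 0 ≤ β := (expect_nonneg M _
      (f := {q : S × A → ℝ | ∀ c ∈ coreSet ρ, |q c - M.Qval π c| ≤ 2 * ε}ᶜ.indicator 1)
      (Set.indicator_nonneg fun _ _ => zero_le_one)).trans (hβ π)
    rw [approxPolicyIteration, expect_bind]
    simp only [Function.iterate_succ_apply]
    refine (expect_mono M (g := fun q => k * β +
      ({q | ∀ c ∈ coreSet ρ, |q c - M.Qval π c| ≤ 2 * ε}ᶜ.indicator 1 : (S × A → ℝ) → ℝ) q)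
      (.of_forall fun q => ?_)).trans ?_
    · by_cases hq : ∀ c ∈ coreSet ρ, |q c - M.Qval π c| ≤ 2 * ε
      · rw [Set.indicator_of_notMem (not_not.2 hq), add_zero]
        exact ih fun σ => M.V_sub_V_greedy_le
          (hρ.abs_lsExtension_sub_le hd hε (hΦ π) hq) (hg _) (hB σ)
      · rw [Set.indicator_of_mem (s := {q : S × A → ℝ |
          ∀ c ∈ coreSet ρ, |q c - M.Qval π c| ≤ 2 * ε}ᶜ) hq, Pi.one_apply]
        refine (expect_mono M (g := fun _ => 1) (.of_forall fun π' => ?_)).trans ?_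
        · exact Set.indicator_le_self' (fun _ _ => zero_le_one) _
        · rw [expect_const]
          exact le_add_of_nonneg_left (by positivity)
    · rw [expect_add, expect_const]
      push_cast
      linarith [hβ π]

/-- Approximate policy iteration succeeds with probability at least `1 - α`. -/
theorem le_prob_approxPolicyIteration {d : ℕ} (hd : 0 < d) {Φ : Matrix (S × A) (Fin d) ℝ}
    {ε α : ℝ} (hε : 0 < ε) (hα0 : 0 < α) (hα1 : α < 1)
    (hΦ : ∀ π : S → A, M.Qval π ∈ hypothesisClass Φ ε) (hρ : IsNearOptimalDesign Φ ρ)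
    {greedy : (S × A → ℝ) → S → A} (hg : IsGreedySelector greedy) (π₁ : S → A) :
    ENNReal.ofReal (1 - α) ≤
      (approxPolicyIteration M.γ Φ ρ greedy
        (numRollouts (numIter d ε M.γ) (coreSet ρ).card ε M.γ α) (rolloutLength ε M.γ)
        (numIter d ε M.γ) π₁).prob M
        {π | ∀ s, M.Vopt s - M.V π s ≤ 13 * ε * √(d : ℝ) / (1 - M.γ) ^ 2} := by
  have hγ0 := M.γ_mem.1
  have hγ1 := M.γ_mem.2
  have h1γ := M.one_sub_γ_pos
  have hs : (0 : ℝ) < √d := Real.sqrt_pos.2 (Nat.cast_pos.2 hd)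
  have hB : ∀ σ s, M.V σ s - M.V π₁ s ≤ 1 / (1 - M.γ) := fun σ s => by
    unfold MDP.V
    linarith [M.Qval_le σ (s, σ s), M.Qval_nonneg π₁ (s, π₁ s)]
  have hc : 0 < (coreSet ρ).card := by
    refine Finset.card_pos.2 (Finset.nonempty_iff_ne_empty.2 fun h => ?_)
    have h1 := hρ.sum_eq_one
    rw [← sum_coreSet ρ fun i hi => hi, h, Finset.sum_empty] at h1
    exact zero_ne_one h1
  set k := numIter d ε M.γ with hk
  set m := numRollouts k (coreSet ρ).card ε M.γ α with hm
  have hγk : M.γ ^ k ≤ ε * √d := pow_natCeil_log_le hγ0.le hγ1 (by positivity)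
  have hn : M.γ ^ rolloutLength ε M.γ / (1 - M.γ) ≤ ε := by
    rw [div_le_iff₀ h1γ]
    exact pow_natCeil_log_le hγ0.le hγ1 (by positivity)
  refine one_sub_le_prob M _ _ ((expect_mono M (.of_forall fun π => ?_)).trans
    (?_ : (approxPolicyIteration M.γ Φ ρ greedy m (rolloutLength ε M.γ) k π₁).expect M
      ({π' | ∀ σ s, M.V σ s - M.V π' s ≤
        (fun x => M.γ * x + 2 * (6 * (ε * √d)) / (1 - M.γ))^[k]
          (1 / (1 - M.γ))}ᶜ.indicator 1) ≤ α))
  · refine Set.indicator_le_indicator_of_subset (Set.compl_subset_compl.2 fun π' hπ' s => ?_)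
      (fun _ => zero_le_one) π
    have h1 := iterate_affine_le (b := 2 * (6 * (ε * √d)) / (1 - M.γ)) hγ0.le hγ1
      (by positivity) k (1 / (1 - M.γ))
    have h2 : M.γ ^ k * (1 / (1 - M.γ)) ≤ ε * √d / (1 - M.γ) ^ 2 := by
      rw [mul_one_div]
      refine div_le_div₀ (by positivity) hγk (by positivity) ?_
      rw [sq]
      exact mul_le_of_le_one_left h1γ.le (by linarith)
    -- The `1` comes from the initial error `γ^k/(1-γ)`, the `12 = 2 · 6` from the accumulated
    -- greedy losses.
    have h3 : 13 * ε * √d / (1 - M.γ) ^ 2 =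
        ε * √d / (1 - M.γ) ^ 2 + 2 * (6 * (ε * √d)) / (1 - M.γ) / (1 - M.γ) := by
      field_simp; ring
    have : Nonempty (S → A) := ⟨π₁⟩
    have h4 : M.Vopt s ≤ M.V π' s + 13 * ε * √d / (1 - M.γ) ^ 2 :=
      ciSup_le fun σ => by
        have h5 : M.V σ s - M.V π' s ≤ _ := hπ' σ s
        linarith
    linarith
  -- For `k = 0` the positivity of `m` may fail, but the output is `π₁`, which meets the initial
  -- bound with certainty.
  · rcases Nat.eq_zero_or_pos k with h0 | hk0
    · rw [h0]
      simp only [approxPolicyIteration, expect]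
      exact (Set.indicator_of_notMem (not_not.2 hB) _).le.trans hα0.le
    · exact (expect_approxPolicyIteration_le M hd hε.le hΦ hρ hg
        (fun π => expect_estimateQ_le M hε (numRollouts_pos hk0 hc hε hγ1 hα0 hα1) hn π)
        k hB).trans (two_mul_exp_numRollouts_le hk0 hc hε hγ1 hα0)

end GenProg

/-! ### The main theorem. -/

theorem theorem6p1 :
    ∃ C : ℝ, 0 < C ∧
      ∀ (S A d : ℕ) (M : MDP (Fin S) (Fin A)) (Φ : Matrix (Fin S × Fin A) (Fin d) ℝ) (ε α : ℝ),
        0 < d → 0 < ε → 0 < α → α < 1 →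
        Submodule.span ℝ (Set.range (fun x : Fin S × Fin A => Φ x)) = ⊤ →
        (∀ π : Fin S → Fin A, M.Qval π ∈ hypothesisClass Φ ε) →
        (∀ (ρ : Fin S × Fin A → ℝ) (greedy : (Fin S × Fin A → ℝ) → Fin S → Fin A)
            (π₁ : Fin S → Fin A) (c k m n : ℕ) (alg : GenProg (Fin S) (Fin A) (Fin S → Fin A)),
          IsNearOptimalDesign Φ ρ → IsGreedySelector greedy →
          c = (coreSet ρ).card →
          k = numIter d ε M.γ →
          m = numRollouts k c ε M.γ α →
          n = rolloutLength ε M.γ →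
          alg = GenProg.approxPolicyIteration M.γ Φ ρ greedy m n k π₁ →
          ENNReal.ofReal (1 - α) ≤
              alg.prob M {π | ∀ s, M.Vopt s - M.V π s ≤ C * ε * √(d : ℝ) / (1 - M.γ) ^ 2} ∧
            alg.QueriesExactly (k * m * n * c) ∧
            ((k * m * n * c : ℕ) : ℝ) ≤
              C * (logPlus (1 / (ε * (1 - M.γ))) * logPlus (2 * k * c / α) *
                logPlus (1 / (ε * √(d : ℝ))) * c / (ε ^ 2 * (1 - M.γ) ^ 4)) ∧
            ((c : ℝ) ≤ 4 * d * Real.log (Real.log d) + 16 →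
              ((k * m * n * c : ℕ) : ℝ) ≤
                C * (logPlus (1 / (ε * (1 - M.γ))) * logPlus (2 * k * c / α) *
                  logPlus (1 / (ε * √(d : ℝ))) * (d * logPlus (Real.log d)) /
                    (ε ^ 2 * (1 - M.γ) ^ 4)))) ∧
        ∃ ρ : Fin S × Fin A → ℝ, IsNearOptimalDesign Φ ρ ∧
          ((coreSet ρ).card : ℝ) ≤ C * (d * logPlus (Real.log d)) := by
  -- `160 = 8 · 20`: the constant of `numSamples_le` times that of the bound on `c` in the last
  -- sample estimate. It exceeds the `13` and `14` needed elsewhere.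
  refine ⟨160, by norm_num, fun S A d M Φ ε α hd hε hα0 hα1 hspan hΦ => ⟨?_, ?_⟩⟩
  · rintro ρ greedy π₁ c k m n alg hρ hg hc rfl rfl rfl rfl
    have h1γ := M.one_sub_γ_pos
    have hγ1 := M.γ_mem.2
    have hd' : (1 : ℝ) ≤ d := Nat.one_le_cast.2 hd
    have hN := numSamples_le hd hε M.γ_mem.1 M.γ_mem.2 α c
    have hL1 := one_le_logPlus (1 / (ε * (1 - M.γ)))
    have hL2 := one_le_logPlus (2 * numIter d ε M.γ * c / α)
    have hL3 := one_le_logPlus (1 / (ε * √(d : ℝ)))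
    have hL4 := one_le_logPlus (Real.log d)
    set X := logPlus (1 / (ε * (1 - M.γ))) * logPlus (2 * numIter d ε M.γ * c / α) *
      logPlus (1 / (ε * √(d : ℝ))) with hX
    have hX0 : 0 ≤ X := by positivity
    set D := ε ^ 2 * (1 - M.γ) ^ 4 with hD
    have hD0 : 0 ≤ X / D := by positivity
    refine ⟨?_, ?_, ?_, fun hcd => ?_⟩
    · subst hc
      refine (GenProg.le_prob_approxPolicyIteration M hd hε hα0 hα1 hΦ hρ hg π₁).trans
        ((PMF.toOuterMeasure _).mono fun π hπ s => (hπ s).trans ?_)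
      gcongr
      norm_num
    · rw [hc]
      exact GenProg.queriesExactly_approxPolicyIteration ..
    · rw [Nat.cast_mul]
      refine (mul_le_mul_of_nonneg_right hN c.cast_nonneg).trans ?_
      have h1 : 160 * (X * c / D) = 160 * (X / D) * c := by ring
      rw [h1]
      gcongr
      norm_num
    · rw [Nat.cast_mul]
      have hdl : (1 : ℝ) ≤ d * logPlus (Real.log d) := one_le_mul_of_one_le_of_one_le hd' hL4
      have h1 : d * Real.log (Real.log d) ≤ d * logPlus (Real.log d) :=
        mul_le_mul_of_nonneg_left (log_le_logPlus _) (by linarith)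
      -- `20 = 4 + 16`. For `d = 1` the convention `log 0 = 0` turns the hypothesis into `c ≤ 16`.
      have h2 : (c : ℝ) ≤ 20 * (d * logPlus (Real.log d)) := by linarith
      refine (mul_le_mul hN h2 c.cast_nonneg (by positivity)).trans (le_of_eq ?_)
      ring
  · obtain ⟨ρ, hρ, h⟩ := exists_isNearOptimalDesign hd hspan
    have hL4 := one_le_logPlus (Real.log d)
    refine ⟨ρ, hρ, h.trans ?_⟩
    gcongr
    norm_num
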